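/- **Conventions.** Quivers $Q=(Q_0,Q_1,\mathfrak s,\mathfrak t)$ are finite; a cycle is considered up to cyclic permutation of its arrows. A quiver with potential (QP) over a field $k$ is a pair $(Q,W)$, where $W=\sum_c a(c)\,c$ is a finite $k$-linear combination of cycles of length at least $3$; the cycles with $a(c)\neq0$ are said to appear in $W$. *Canvas.* The canvas $X_{(Q,W)}$ is the $2$-dimensional CW-complex with set of $0$-cells $Q_0$, one $1$-cell for each $\alpha\in Q_1$, attached at $\mathfrak s(\alpha)$ and $\mathfrak t(\alpha)$, and one $2$-cell for each cycle $c$ that appears in $W$: if $c$ traverses successively the arrows $\alpha_0,\dots,\alpha_{l-1}$, then the arc of $\partial D^2$ with angles in $[2\pi i/l,2\pi(i+1)/l]$ is attached along $\alpha_i$. The QP is *planar* if $X_{(Q,W)}$ is simply connected and embeds in $\mathbb R^2$, and *strongly planar* if moreover $X_{(Q,W)}$ is homeomorphic to a closed disk. *Rotations.* Let $G$ be a cyclic group acting on $Q$ by quiver automorphisms. It acts on $(Q,W)$ *by rotations* if (a) for some generator $h$ of $G$ there are an embedding of $X_{(Q,W)}$ in $\mathbb R^2$ and a rotation of the plane that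 induces the action of $h$ on $X_{(Q,W)}$ (on vertices and arrows, and carrying the face of each cycle $c$ appearing in $W$ onto the face of $h(c)$, which has to appear in $W$ as well); (b) the action on $Q$ is faithful; (c) every cycle appearing in $W$ passes, counting multiplicity, (i) through no fixed vertex, or (ii) through exactly one fixed vertex, or (iii) through exactly one non-fixed vertex, or (iv) only through fixed vertices. Here "fixed" means fixed by $G$. *The QP $(Q_G,W_G)$.* Let $n=|G|$, let $g$ be a generator of $G$, let $\zeta\in k$ be a primitive $n$-th root of unity, let $\mathcal E\subseteq Q_0$ be a set of representatives of the $G$-orbits of vertices, and assume that every arrow between two fixed vertices is fixed by $G$. The vertices of $Q_G$ are $\eta^\varepsilon$ for $\varepsilon\in\mathcal E$ not fixed and $\eta^\varepsilon_\mu$ ($\mu\in\mathbb Z/n$) for $\varepsilon\in\mathcal E$ fixed. The arrows of $Q_G$ are: (1) $\tilde\alpha:\eta^\varepsilon\to\eta^{\varepsilon'}$ for each arrow $\alpha:g^t\varepsilon\to\varepsilon'$ with $\varepsilon,\varepsilon'\in\mathcal E$ not fixed; and, for $\mu\in\mathbb Z/n$ and each arrow $\alpha:\varepsilon\to\varepsilon'$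 with $\varepsilon,\varepsilon'\in\mathcal E$, (2) $\tilde\alpha^\mu:\eta^\varepsilon\to\eta^{\varepsilon'}_\mu$ if only $\varepsilon'$ is fixed, (3) $\tilde\alpha^\mu:\eta^\varepsilon_\mu\to\eta^{\varepsilon'}$ if only $\varepsilon$ is fixed, (4) $\tilde\alpha^\mu:\eta^\varepsilon_\mu\to\eta^{\varepsilon'}_\mu$ if both are fixed. Each $G$-orbit of arrows of $Q$ contains exactly one arrow $\alpha$ of one of these four kinds. Let $\mathcal C$ be a cross-section of the $G$-orbits of cycles appearing in $W$, such that each $c\in\mathcal C$ of type (i) passes through a vertex of $\mathcal E$, the arrow of each $c\in\mathcal C$ of type (ii) that starts at the fixed vertex ends in $\mathcal E$, and each $c\in\mathcal C$ of type (iii) has its non-fixed vertex in $\mathcal E$. For $c\in\mathcal C$ let $\tilde c$ (type (i)), respectively $\tilde c^\mu$, $0\le\mu<n$ (types (ii)-(iv)), be the cycle of $Q_G$ obtained by replacing each arrow of $c$ by $\tilde\alpha$ or $\tilde\alpha^\mu$, where $\alpha$ is the arrow of kind (1)-(4) in its orbit. For $c$ of type (ii) let $p(c)\in\{0,\dots,n-1\}$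 be such that the arrow of $c$ that ends at the fixed vertex starts in $g^{p(c)}\mathcal E$. Then $$W_G=\sum_{c\in\mathcal C(\mathrm i)}a(c)\frac{|Gc|}{n}\,\tilde c+\sum_{c\in\mathcal C(\mathrm{ii})}a(c)\sum_{\mu=0}^{n-1}\zeta^{-p(c)\mu}\,\tilde c^{\mu}+\sum_{c\in\mathcal C(\mathrm{iii})\cup\mathcal C(\mathrm{iv})}a(c)\sum_{\mu=0}^{n-1}\tilde c^{\mu},$$ where $\mathcal C(x)$ is the set of cycles in $\mathcal C$ of type $x$. **Proposition.** Let $(Q,W)$ be a strongly planar QP with a cyclic group $G$ acting by rotations, such that every arrow between two fixed vertices is fixed by $G$, and assume that some vertex of $Q$ is fixed by $G$. Then, for all choices of $g$, $\zeta$, $\mathcal E$ and $\mathcal C$ as above, the canvas $X_{(Q_G,W_G)}$ is simply connected. -/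

import Mathlib

open scoped Classical

noncomputable section

/-! ## Quivers, potentials -/

/-- A quiver with vertex set `V` and arrow set `A`; the arrow `a` goes from `src a` to `tgt a`. -/
structure RepQuiver (V A : Type*) where
  src : A → V
  tgt : A → V

/-- A cyclic word in the arrows, in the order in which it is traversed, is a cycle of the quiver
when each arrow ends where the cyclically next one starts. -/
def RepQuiver.IsCycle {V A : Type*} (Q : RepQuiver V A) (c : Cycle A) : Prop :=
  c.Chain fun a b => Q.tgt a = Q.src b

/-- A quiver with (finite) potential: the potential is a finite `k`-linear combination of cycles of
length at least three, a cycle being considered up to cyclic permutation of its arrows. -/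
structure QP (k V A : Type*) [Field k] extends RepQuiver V A where
  W : Cycle A →₀ k
  isCycle : ∀ c ∈ W.support, toRepQuiver.IsCycle c
  three_le : ∀ c ∈ W.support, 3 ≤ c.length

/-! ## The canvas -/

namespace QP

variable {k V A : Type*} [Field k]

/-- The set indexing the 2-cells: the cycles (up to cyclic permutation) that appear in `W`. -/
abbrev Face (X : QP k V A) : Type _ := {c : Cycle A // c ∈ X.W.support}

/-- A chosen representative `α₀, …, α_{l-1}` of the cycle of a face. -/
def Face.word {X : QP k V A} (c : X.Face) : List A :=
  Quotient.out (s := List.IsRotated.setoid A) c.1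

/-- The closed unit disk. -/
abbrev Disk : Type := Metric.closedBall (0 : ℂ) 1

/-- The boundary point of the disk with argument `2πx`. -/
def circlePoint (x : ℝ) : Disk :=
  ⟨Complex.exp ((2 * Real.pi * x : ℝ) * Complex.I), by
    rw [mem_closedBall_zero_iff, Complex.norm_exp_ofReal_mul_I]⟩

/-- The disjoint union of a discrete set of points indexed by the vertices, of unit intervals
indexed by the arrows and of closed disks indexed by the faces. -/
abbrev PreCanvas (X : QP k V A) : Type _ :=
  (Σ _ : V, Unit) ⊕ (Σ _ : A, unitInterval) ⊕ (Σ _ : X.Face, Disk)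

/-- The gluing: an interval is attached along its end points, and the `i`-th of the `l` arcs of the
boundary of the disk of a cycle `α₀, …, α_{l-1}` is attached along the arrow `α_i`. -/
inductive Glue (X : QP k V A) : X.PreCanvas → X.PreCanvas → Prop
  | start (a : A) : Glue X (.inr (.inl ⟨a, 0⟩)) (.inl ⟨X.src a, ()⟩)
  | finish (a : A) : Glue X (.inr (.inl ⟨a, 1⟩)) (.inl ⟨X.tgt a, ()⟩)
  | face (c : X.Face) (i : Fin c.word.length) (t : unitInterval) :
      Glue X (.inr (.inr ⟨c, circlePoint (((i : ℕ) + (t : ℝ)) / c.word.length)⟩))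
        (.inr (.inl ⟨c.word.get i, t⟩))

/-- The canvas of a quiver with potential: the 2-dimensional CW complex obtained by the above
gluing, with the quotient topology. -/
def Canvas (X : QP k V A) : Type _ := Quot X.Glue

instance (X : QP k V A) : TopologicalSpace X.Canvas :=
  inferInstanceAs (TopologicalSpace (Quot X.Glue))

/-- The 0-cell of a vertex. -/
def vertexPt (X : QP k V A) (v : V) : X.Canvas := Quot.mk _ (.inl ⟨v, ()⟩)

/-- The characteristic map of the 1-cell of an arrow. -/
def edgePt (X : QP k V A) (a : A) (t : unitInterval) : X.Canvas := Quot.mk _ (.inr (.inl ⟨a, t⟩))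

/-- The characteristic map of the 2-cell of a face. -/
def facePt (X : QP k V A) (c : X.Face) (z : Disk) : X.Canvas := Quot.mk _ (.inr (.inr ⟨c, z⟩))

/-- A quiver with potential is planar if its canvas is simply connected and embeds into the
plane. -/
def IsPlanar (X : QP k V A) : Prop :=
  SimplyConnectedSpace X.Canvas ∧ ∃ φ : X.Canvas → ℂ, Topology.IsEmbedding φ

/-- Strongly planar: planar, and the canvas is homeomorphic to a (closed) disk. -/
def IsStronglyPlanar (X : QP k V A) : Prop :=
  X.IsPlanar ∧ Nonempty (X.Canvas ≃ₜ Disk)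

end QP

/-! ## Group actions on quivers -/

/-- The actions of `G` on vertices and on arrows form an action of `G` on the quiver by quiver
automorphisms. -/
class RepQuiver.IsActedOnBy {V A : Type*} (Q : RepQuiver V A) (G : Type*) [Group G] [MulAction G V]
    [MulAction G A] : Prop where
  src_smul : ∀ (h : G) (a : A), Q.src (h • a) = h • Q.src a
  tgt_smul : ∀ (h : G) (a : A), Q.tgt (h • a) = h • Q.tgt a

/-- The vertex `v` is fixed by `G`. -/
def IsFixedVertex (G : Type*) {V : Type*} [Group G] [MulAction G V] (v : V) : Prop :=
  ∀ h : G, h • v = v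

/-- The translate of a cycle by a group element. -/
def translateCycle {G A : Type*} [Group G] [MulAction G A] (h : G) (c : Cycle A) : Cycle A :=
  c.map fun a => h • a

/-- The orbit of a cycle. -/
def cycleOrbit (G : Type*) {A : Type*} [Group G] [MulAction G A] (c : Cycle A) : Set (Cycle A) :=
  Set.range fun h : G => translateCycle h c

section Types

variable {V A : Type*} (Q : RepQuiver V A) (G : Type*) [Group G] [MulAction G V]

/-- The number of passages of a cycle through fixed vertices, counted with multiplicity. -/
def RepQuiver.fixedCount (c : Cycle A) : ℕ :=
  (c.toMultiset.map Q.src).countP (IsFixedVertex G)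

/-- The cycle goes through no fixed vertex. -/
def RepQuiver.TypeI (c : Cycle A) : Prop := Q.fixedCount G c = 0

/-- The cycle goes through exactly one (with multiplicity) fixed vertex. -/
def RepQuiver.TypeII (c : Cycle A) : Prop := Q.fixedCount G c = 1

/-- The cycle goes through exactly one (with multiplicity) vertex that is not fixed. -/
def RepQuiver.TypeIII (c : Cycle A) : Prop := Q.fixedCount G c + 1 = c.length

/-- The cycle goes only through fixed vertices. -/
def RepQuiver.TypeIV (c : Cycle A) : Prop := Q.fixedCount G c = c.length

end Types

/-- The rotation of the plane `ℂ` with centre `p` and angle `arg w`. -/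
def planeRotation (p : ℂ) (w : Circle) (z : ℂ) : ℂ := p + (w : ℂ) * (z - p)

/-- The action of `h : G` is induced by a rotation of the plane: there are an embedding of the
canvas into the plane and a rotation which restricts to the action of `h` on the 1-skeleton and
which carries the face of every cycle `c` of `W` onto the face of the translate of `c`. -/
def IsInducedByRotation {k V A G : Type*} [Field k] [Group G] [MulAction G V] [MulAction G A]
    (X : QP k V A) (h : G) : Prop :=
  ∃ (φ : X.Canvas → ℂ) (p : ℂ) (w : Circle), Topology.IsEmbedding φ ∧
    (∀ v : V, planeRotation p w (φ (X.vertexPt v)) = φ (X.vertexPt (h • v))) ∧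
    (∀ (a : A) (t : unitInterval),
      planeRotation p w (φ (X.edgePt a t)) = φ (X.edgePt (h • a) t)) ∧
    ∀ c : X.Face, ∃ d : X.Face, d.1 = translateCycle h c.1 ∧
      planeRotation p w '' (φ '' Set.range (X.facePt c)) = φ '' Set.range (X.facePt d)

/-- The cyclic group `G` acts on the quiver with potential by rotations: a generator of `G` is
induced by a rotation of the plane, the action is faithful, and every cycle of the potential has
one of the four types. -/
structure ActsByRotations {k V A : Type*} [Field k] (X : QP k V A) (G : Type*) [Group G]
    [MulAction G V] [MulAction G A] : Prop where
  rotation : ∃ h : G, (∀ x : G, x ∈ Subgroup.zpowers h) ∧ IsInducedByRotation X h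
  faithful : ∀ h : G, (∀ v : V, h • v = v) → (∀ a : A, h • a = a) → h = 1
  types : ∀ c ∈ X.W.support,
    X.TypeI G c ∨ X.TypeII G c ∨ X.TypeIII G c ∨ X.TypeIV G c

/-! ## The quiver with potential of the skew group algebra -/

/-- A set of representatives of the vertices under the action of `G`. -/
structure VertexReps (G V : Type*) [Group G] [MulAction G V] where
  E : Set V
  existsUnique : ∀ v : V, ∃! e : V, e ∈ E ∧ e ∈ MulAction.orbit G v

namespace VertexReps

variable {G V : Type*} [Group G] [MulAction G V] (R : VertexReps G V)

theorem exists_smul_mem (v : V) : ∃ h : G, h • v ∈ R.E := by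
  obtain ⟨e, ⟨he, h, rfl⟩, -⟩ := R.existsUnique v
  exact ⟨h, he⟩

/-- A group element carrying `v` to the representative of its orbit. -/
def toRep (v : V) : G := (R.exists_smul_mem v).choose

theorem toRep_smul_mem (v : V) : R.toRep v • v ∈ R.E := (R.exists_smul_mem v).choose_spec

/-- The representative of the orbit of `v`. -/
def rep (v : V) : V := R.toRep v • v

theorem rep_mem (v : V) : R.rep v ∈ R.E := R.toRep_smul_mem v

theorem eq_rep {v : V} {h : G} (hv : h • v ∈ R.E) : h • v = R.rep v :=
  (R.existsUnique v).unique ⟨hv, h, rfl⟩ ⟨R.rep_mem v, R.toRep v, rfl⟩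

theorem rep_smul (h : G) (v : V) : R.rep (h • v) = R.rep v := by
  have h1 : R.rep (h • v) = (R.toRep (h • v) * h) • v := by rw [mul_smul]; rfl
  rw [h1]
  apply R.eq_rep
  rw [← h1]
  exact R.rep_mem _

theorem rep_of_mem {v : V} (hv : v ∈ R.E) : R.rep v = v := by
  have := R.eq_rep (v := v) (h := 1) (by rwa [one_smul])
  rw [one_smul] at this
  exact this.symm

end VertexReps

theorem isFixedVertex_smul {G V : Type*} [Group G] [MulAction G V] (h : G) (v : V) :
    IsFixedVertex G (h • v) ↔ IsFixedVertex G v := by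
  constructor
  · intro H
    have h1 : v = h • v := by
      have := H h⁻¹
      rwa [inv_smul_smul] at this
    rw [h1]
    exact H
  · intro H
    rw [H h]
    exact H

theorem VertexReps.mem_of_isFixed {G V : Type*} [Group G] [MulAction G V] (R : VertexReps G V)
    {v : V} (hv : IsFixedVertex G v) : v ∈ R.E := by
  have := R.toRep_smul_mem v
  rwa [hv] at this

section Skew

variable {k V A : Type*} [Field k] {G : Type*} [Group G] [MulAction G V] [MulAction G A]

/-- The vertices of `Q_G`: one vertex `η^ε` for each non-fixed representative `ε`, and vertices
`η^ε_μ`, `μ ∈ ℤ/n`, for each fixed one, where `n = |G|`. -/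
inductive SkewVertex (R : VertexReps G V)
  | free (v : V) (hE : v ∈ R.E) (hv : ¬ IsFixedVertex G v)
  | fixed (v : V) (hE : v ∈ R.E) (hv : IsFixedVertex G v) (μ : ZMod (Nat.card G))

/-- The arrows of `Q_G`: an arrow `α̃` for each `α` of type (1), and arrows `α̃^μ`, `μ ∈ ℤ/n`, for
each `α` of one of the types (2), (3), (4). -/
inductive SkewArrow (Q : RepQuiver V A) (R : VertexReps G V)
  | type1 (a : A) (hs : ¬ IsFixedVertex G (Q.src a)) (ht : ¬ IsFixedVertex G (Q.tgt a))
      (hE : Q.tgt a ∈ R.E)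
  | type2 (a : A) (hs : ¬ IsFixedVertex G (Q.src a)) (ht : IsFixedVertex G (Q.tgt a))
      (hE : Q.src a ∈ R.E) (μ : ZMod (Nat.card G))
  | type3 (a : A) (hs : IsFixedVertex G (Q.src a)) (ht : ¬ IsFixedVertex G (Q.tgt a))
      (hE : Q.tgt a ∈ R.E) (μ : ZMod (Nat.card G))
  | type4 (a : A) (hs : IsFixedVertex G (Q.src a)) (ht : IsFixedVertex G (Q.tgt a))
      (μ : ZMod (Nat.card G))

/-- The quiver `Q_G`. An arrow `g^t ε → ε'` of type (1) gives `η^ε → η^ε'`, an arrow `ε → ε'` of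
type (2), (3), (4) gives `η^ε → η^ε'_μ`, `η^ε_μ → η^ε'`, `η^ε_μ → η^ε'_μ` respectively. (The arrows
between fixed vertices are fixed by `G`, so that there is no shift of `μ` in type (4).) -/
def skewQuiver (Q : RepQuiver V A) (R : VertexReps G V) :
    RepQuiver (SkewVertex R) (SkewArrow Q R) where
  src
    | .type1 a hs _ _ => .free (R.rep (Q.src a)) (R.rep_mem _) (by
        rwa [VertexReps.rep, isFixedVertex_smul])
    | .type2 a hs _ hE _ => .free (Q.src a) hE hs
    | .type3 a hs _ _ μ => .fixed (Q.src a) (R.mem_of_isFixed hs) hs μ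
    | .type4 a hs _ μ => .fixed (Q.src a) (R.mem_of_isFixed hs) hs μ
  tgt
    | .type1 a _ ht hE => .free (Q.tgt a) hE ht
    | .type2 a _ ht _ μ => .fixed (Q.tgt a) (R.mem_of_isFixed ht) ht μ
    | .type3 a _ ht hE _ => .free (Q.tgt a) hE ht
    | .type4 a _ ht μ => .fixed (Q.tgt a) (R.mem_of_isFixed ht) ht μ

variable (Q : RepQuiver V A) [Q.IsActedOnBy G] (R : VertexReps G V)

/-- For an arrow `b` of `Q`, the arrow `α̃` or `α̃^μ` of `Q_G`, where `α` is the arrow of one of the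
types (1)-(4) in the orbit of `b`. -/
def tildeArrow (μ : ZMod (Nat.card G)) (b : A) : SkewArrow Q R :=
  if ht : IsFixedVertex G (Q.tgt b) then
    if hs : IsFixedVertex G (Q.src b) then .type4 b hs ht μ
    else .type2 (R.toRep (Q.src b) • b)
      (by rwa [RepQuiver.IsActedOnBy.src_smul, isFixedVertex_smul])
      (by rwa [RepQuiver.IsActedOnBy.tgt_smul, isFixedVertex_smul])
      (by rw [RepQuiver.IsActedOnBy.src_smul]; exact R.toRep_smul_mem _) μ
  else
    if hs : IsFixedVertex G (Q.src b) then .type3 (R.toRep (Q.tgt b) • b)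
      (by rwa [RepQuiver.IsActedOnBy.src_smul, isFixedVertex_smul])
      (by rwa [RepQuiver.IsActedOnBy.tgt_smul, isFixedVertex_smul])
      (by rw [RepQuiver.IsActedOnBy.tgt_smul]; exact R.toRep_smul_mem _) μ
    else .type1 (R.toRep (Q.tgt b) • b)
      (by rwa [RepQuiver.IsActedOnBy.src_smul, isFixedVertex_smul])
      (by rwa [RepQuiver.IsActedOnBy.tgt_smul, isFixedVertex_smul])
      (by rw [RepQuiver.IsActedOnBy.tgt_smul]; exact R.toRep_smul_mem _)

/-- The vertex of `Q_G` below a vertex of `Q`, with superscript `μ` if it is fixed. -/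
def tildeVertex (μ : ZMod (Nat.card G)) (v : V) : SkewVertex R :=
  if hv : IsFixedVertex G v then .fixed v (R.mem_of_isFixed hv) hv μ
  else .free (R.rep v) (R.rep_mem v) (by rwa [VertexReps.rep, isFixedVertex_smul])

theorem src_tildeArrow (μ : ZMod (Nat.card G)) (b : A) :
    (skewQuiver Q R).src (tildeArrow Q R μ b) = tildeVertex R μ (Q.src b) := by
  by_cases ht : IsFixedVertex G (Q.tgt b) <;> by_cases hs : IsFixedVertex G (Q.src b)
  · simp [tildeArrow, tildeVertex, skewQuiver, hs, ht]
  · simp [tildeArrow, tildeVertex, skewQuiver, hs, ht, RepQuiver.IsActedOnBy.src_smul,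
      VertexReps.rep]
  · simp [tildeArrow, tildeVertex, skewQuiver, hs, ht, RepQuiver.IsActedOnBy.src_smul,
      hs (R.toRep (Q.tgt b))]
  · simp [tildeArrow, tildeVertex, skewQuiver, hs, ht, RepQuiver.IsActedOnBy.src_smul,
      VertexReps.rep_smul]

theorem tgt_tildeArrow (μ : ZMod (Nat.card G)) (b : A) :
    (skewQuiver Q R).tgt (tildeArrow Q R μ b) = tildeVertex R μ (Q.tgt b) := by
  by_cases ht : IsFixedVertex G (Q.tgt b) <;> by_cases hs : IsFixedVertex G (Q.src b)
  · simp [tildeArrow, tildeVertex, skewQuiver, hs, ht]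
  · simp [tildeArrow, tildeVertex, skewQuiver, hs, ht, RepQuiver.IsActedOnBy.tgt_smul,
      ht (R.toRep (Q.src b))]
  · simp [tildeArrow, tildeVertex, skewQuiver, hs, ht, RepQuiver.IsActedOnBy.tgt_smul,
      VertexReps.rep]
  · simp [tildeArrow, tildeVertex, skewQuiver, hs, ht, RepQuiver.IsActedOnBy.tgt_smul,
      VertexReps.rep]

/-- The cycle `c̃` (for `c` of type (i), where it does not depend on `μ`) or `c̃^μ` (for the other
types). -/
def tildeCycle (μ : ZMod (Nat.card G)) (c : Cycle A) : Cycle (SkewArrow Q R) :=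
  c.map (tildeArrow Q R μ)

theorem isCycle_tildeCycle (μ : ZMod (Nat.card G)) {c : Cycle A} (hc : Q.IsCycle c) :
    (skewQuiver Q R).IsCycle (tildeCycle Q R μ c) := by
  unfold RepQuiver.IsCycle tildeCycle
  rw [Cycle.chain_map]
  refine hc.imp fun a b hab => ?_
  rw [tgt_tildeArrow, src_tildeArrow, hab]

theorem length_tildeCycle (μ : ZMod (Nat.card G)) (c : Cycle A) :
    (tildeCycle Q R μ c).length = c.length := by
  induction c using Quotient.inductionOn' with
  | h l => exact List.length_map _

/-- The exponent `t ∈ {0, …, n-1}` such that `v` lies in `g^t E`. -/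
def shiftOf (g : G) (v : V) : ℕ := sInf {t : ℕ | ∃ e ∈ R.E, g ^ t • e = v}

/-- For a cycle `c` of type (ii) the number `p(c)`: the arrow of `c` that ends in the fixed vertex
starts in `g^{p(c)} E`. -/
def pOf (g : G) (c : Cycle A) : ℕ :=
  ((c.toMultiset.filter fun a => IsFixedVertex G (Q.tgt a)).map
    fun a => shiftOf R g (Q.src a)).sum

/-- `C` is a cross-section `{ĉ}` of the cycles of the potential `X.W` under `G`, chosen as required
by the set of representatives of the vertices. -/
structure IsCrossSection (X : QP k V A) (R : VertexReps G V) (C : Finset (Cycle A)) : Prop where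
  subset : C ⊆ X.W.support
  existsUnique : ∀ c ∈ X.W.support, ∃! d : Cycle A, d ∈ C ∧ d ∈ cycleOrbit G c
  typeI : ∀ c ∈ C, X.TypeI G c → ∃ a ∈ c, X.src a ∈ R.E
  typeII : ∀ c ∈ C, X.TypeII G c → ∀ a ∈ c, IsFixedVertex G (X.src a) → X.tgt a ∈ R.E
  typeIII : ∀ c ∈ C, X.TypeIII G c → ∀ a ∈ c, ¬ IsFixedVertex G (X.tgt a) → X.tgt a ∈ R.E

/-- The contribution of `c = ĉ` to the potential `W_G`. -/
def skewTerm (X : QP k V A) [X.IsActedOnBy G] (R : VertexReps G V) (g : G) (ζ : k) (c : Cycle A) :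
    Cycle (SkewArrow X.toRepQuiver R) →₀ k :=
  if X.TypeI G c then
    Finsupp.single (tildeCycle X.toRepQuiver R 0 c)
      (X.W c * ((cycleOrbit G c).ncard : k) / (Nat.card G : k))
  else if X.TypeII G c then
    ∑ μ ∈ Finset.range (Nat.card G), Finsupp.single (tildeCycle X.toRepQuiver R (μ : ZMod _) c)
      (X.W c * ζ⁻¹ ^ (pOf X.toRepQuiver R g c * μ))
  else
    ∑ μ ∈ Finset.range (Nat.card G), Finsupp.single (tildeCycle X.toRepQuiver R (μ : ZMod _) c)
      (X.W c)

/-- The potential `W_G`. -/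
def skewPotential (X : QP k V A) [X.IsActedOnBy G] (R : VertexReps G V) (g : G) (ζ : k)
    (C : Finset (Cycle A)) : Cycle (SkewArrow X.toRepQuiver R) →₀ k :=
  ∑ c ∈ C, skewTerm X R g ζ c

theorem exists_of_mem_support_skewPotential (X : QP k V A) [X.IsActedOnBy G] (R : VertexReps G V)
    (g : G) (ζ : k) (C : Finset (Cycle A)) {d : Cycle (SkewArrow X.toRepQuiver R)}
    (hd : d ∈ (skewPotential X R g ζ C).support) :
    ∃ c ∈ C, ∃ μ, d = tildeCycle X.toRepQuiver R μ c := by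
  obtain ⟨c, hc, h⟩ := Finset.mem_biUnion.1 (Finsupp.support_finsetSum hd)
  refine ⟨c, hc, ?_⟩
  unfold skewTerm at h
  split_ifs at h
  · exact ⟨0, Finset.mem_singleton.1 (Finsupp.support_single_subset h)⟩
  all_goals
    obtain ⟨μ, -, h'⟩ := Finset.mem_biUnion.1 (Finsupp.support_finsetSum h)
    exact ⟨_, Finset.mem_singleton.1 (Finsupp.support_single_subset h')⟩

/-- The quiver with potential `(Q_G, W_G)`; it depends on the set of representatives `R` of the
vertices, on the generator `g` of `G`, on the root of unity `ζ` and on the cross-section `C`. -/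
def skewQP (X : QP k V A) [X.IsActedOnBy G] (R : VertexReps G V) (g : G) (ζ : k)
    (C : Finset (Cycle A)) (hC : IsCrossSection X R C) :
    QP k (SkewVertex R) (SkewArrow X.toRepQuiver R) where
  toRepQuiver := skewQuiver X.toRepQuiver R
  W := skewPotential X R g ζ C
  isCycle d hd := by
    obtain ⟨c, hc, μ, rfl⟩ := exists_of_mem_support_skewPotential X R g ζ C hd
    exact isCycle_tildeCycle _ R μ (X.isCycle c (hC.subset hc))
  three_le d hd := by
    obtain ⟨c, hc, μ, rfl⟩ := exists_of_mem_support_skewPotential X R g ζ C hd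
    rw [length_tildeCycle]
    exact X.three_le c (hC.subset hc)

end Skew

end

noncomputable section

open unitInterval

/-! If `G` is trivial, every vertex is fixed, and one canvas map, which is injective on vertices and
on arrows, does everything. Otherwise faithfulness makes each nontrivial element act as a nontrivial
rotation about a common centre. Such a rotation fixes only the centre, so there is exactly one fixed
vertex `v₀`, the action on the other vertices is free, and no arrow goes from `v₀` to itself
(`ActsByRotations.exists_unique_fixed`). Hence every cycle of `W` passes at most once through `v₀`.

For each `μ` the assignment of tilde arrows and tilde cycles gives a map `Ψ μ` from the canvas of
`Q` to that of `Q_G`. This requires every tilde cycle to appear in `W_G`, that is, that nothing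
cancels (`tildeCycle_mem_support_skewPotential`). Together these maps reach all vertices and arrows
of `Q_G`.

Simple connectedness is tested without covering spaces. It suffices to choose for every point `x` a
class of paths from `x` to a base point so that the choice is compatible with every path. By
subdivision, small paths are enough, and since intervals and disks are simply connected, it is
enough to choose classes at the vertices that are compatible along arrows
(`QP.simplyConnectedSpace_canvas`).

To find these classes, lift each `Ψ μ` to path classes, which is possible because the canvas of `Q`
is simply connected, and normalise all lifts `φ μ` at one vertex `u ≠ v₀`. The lifts must agree on
vertices with the same image. A disk minus a point is connected, so the quiver stays connected when
`v₀` is removed (`vertex_of_isPreconnected_compl`). Agreement of `φ μ` and `φ ν` therefore spreads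
from `u` to all vertices other than `v₀`. Invariance of `φ μ` under `x ∈ G` starts at `v₀`, which
`x` fixes, passes along an arrow at `v₀` to a free vertex, and spreads in the same way. -/

instance : ContractibleSpace I := (convex_Icc (0 : ℝ) 1).contractibleSpace ⟨0, by simp⟩

/-! ### Simple connectedness from a coherent choice of path classes. -/

section PathClasses

variable {Z : Type*} [TopologicalSpace Z]

/-- A space is simply connected as soon as every point has a distinguished class of paths to a base
point which is compatible with all sufficiently small paths. -/
theorem simplyConnectedSpace_of_classes {ι : Type*} (b : Z)
    (P : ∀ x : Z, Path.Homotopic.Quotient x b) (U : ι → Set Z) (hU : ∀ i, IsOpen (U i))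
    (hcov : ∀ x, ∃ i, x ∈ U i)
    (hP : ∀ i (x y : Z) (γ : Path x y), (∀ t, γ t ∈ U i) →
      (Path.Homotopic.Quotient.mk γ).trans (P y) = P x) :
    SimplyConnectedSpace Z := by
  have key : ∀ (x y : Z) (γ : Path x y), (Path.Homotopic.Quotient.mk γ).trans (P y) = P x := by
    intro x y γ
    obtain ⟨t, ht0, hmono, ⟨n, hn⟩, ht⟩ := exists_monotone_Icc_subset_open_cover_unitInterval
      (c := fun i => γ ⁻¹' U i) (fun i => (hU i).preimage γ.continuous)
      (fun s _ => by simpa using hcov (γ s))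
    -- Compatibility is propagated along a subdivision of `γ` into pieces that each lie in one of
    -- the open sets.
    have step : ∀ m : ℕ, (Path.Homotopic.Quotient.mk (γ.subpath 0 (t m))).trans (P (γ (t m)))
        = P (γ 0) := by
      intro m
      induction m with
      | zero =>
        rw [ht0]
        simp
      | succ m ih =>
        obtain ⟨i, hi⟩ := ht m
        have h1 := hP i _ _ (γ.subpath (t m) (t (m + 1))) (fun s => by
          have : γ.subpath (t m) (t (m + 1)) s ∈ Set.range (γ.subpath (t m) (t (m + 1))) := ⟨s, rfl⟩
          rw [Path.range_subpath_of_le _ _ _ (hmono (Nat.le_succ m))] at this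
          obtain ⟨u, hu, hu'⟩ := this
          rw [← hu']
          exact hi hu)
        have h2 : Path.Homotopic.Quotient.mk (γ.subpath 0 (t (m + 1))) =
            (Path.Homotopic.Quotient.mk (γ.subpath 0 (t m))).trans
              (Path.Homotopic.Quotient.mk (γ.subpath (t m) (t (m + 1)))) := by
          rw [← Path.Homotopic.Quotient.mk_trans, Path.Homotopic.Quotient.eq]
          exact ⟨(Path.Homotopy.subpathTransSubpath γ 0 (t m) (t (m + 1))).symm⟩
        rw [h2, Path.Homotopic.Quotient.trans_assoc, h1, ih]
    have h3 := step n
    rw [hn n le_rfl, Path.subpath_zero_one, Path.Homotopic.Quotient.mk_cast] at h3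
    -- The points `γ 0` and `γ 1` equal `x` and `y` only propositionally, hence the transport.
    have h4 : ∀ (x' y' : Z) (hx : x' = x) (hy : y' = y),
        ((Path.Homotopic.Quotient.mk γ).cast hx hy).trans (P y') = P x' →
        (Path.Homotopic.Quotient.mk γ).trans (P y) = P x := by
      rintro _ _ rfl rfl h
      simpa using h
    exact h4 _ _ _ _ h3
  rw [simply_connected_iff_unique_homotopic]
  -- By `key`, any path from `x` to `y` has the class of `P x` followed by the reverse of `P y`.
  refine ⟨⟨b⟩, fun x y => ⟨⟨⟨(P x).trans (P y).symm⟩, fun q => ?_⟩⟩⟩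
  induction q with | mk q =>
  change _ = (P x).trans (P y).symm
  rw [← key x y q]
  simp

/-- The path traced by a point under a homotopy that starts at the identity. -/
def trackPath (H : C(Z, C(I, Z))) (h0 : ∀ x, H x 0 = x) (x : Z) : Path x (H x 1) where
  toFun := H x
  source' := h0 x
  target' := rfl

/-- The image of a path under the end map of a homotopy. -/
def endPath (H : C(Z, C(I, Z))) {x y : Z} (γ : Path x y) : Path (H x 1) (H y 1) where
  toFun t := H (γ t) 1
  continuous_toFun := (ContinuousEvalConst.continuous_eval_const 1).comp
    (H.continuous.comp γ.continuous)
  source' := by simp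
  target' := by simp

/-- The map `(s, τ) ↦ H (γ s) τ` is defined on the square, which is simply connected; the two sides
of the equation are the images of the two ways round its boundary. -/
theorem trans_trackPath (H : C(Z, C(I, Z))) (h0 : ∀ x, H x 0 = x) {x y : Z} (γ : Path x y) :
    (Path.Homotopic.Quotient.mk γ).trans (Path.Homotopic.Quotient.mk (trackPath H h0 y)) =
      (Path.Homotopic.Quotient.mk (trackPath H h0 x)).trans
        (Path.Homotopic.Quotient.mk (endPath H γ)) := by
  have hc : Continuous fun p : I × I => H (γ p.1) p.2 :=
    (ContinuousMap.continuous_uncurry_of_continuous (H.comp γ.toContinuousMap))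
  let f : C(I × I, Z) := ⟨_, hc⟩
  let a : Path ((0, 0) : I × I) (1, 0) :=
    ⟨⟨fun t => (t, 0), by fun_prop⟩, rfl, rfl⟩
  let a' : Path ((1, 0) : I × I) (1, 1) :=
    ⟨⟨fun t => (1, t), by fun_prop⟩, rfl, rfl⟩
  let c : Path ((0, 0) : I × I) (0, 1) :=
    ⟨⟨fun t => (0, t), by fun_prop⟩, rfl, rfl⟩
  let c' : Path ((0, 1) : I × I) (1, 1) :=
    ⟨⟨fun t => (t, 1), by fun_prop⟩, rfl, rfl⟩
  have hh : Path.Homotopic (a.trans a') (c.trans c') := SimplyConnectedSpace.paths_homotopic _ _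
  have hm := hh.map f
  have e : ∀ {u v w u' v' w' : Z} (hu : u' = u) (hv : v' = v) (hw : w' = w) {v1 v1'} (hv1 : v1' = v1)
      (p : Path u v) (q : Path v w) (r : Path u v1) (s : Path v1 w),
      (p.trans q).Homotopic (r.trans s) →
      ((p.cast hu hv).trans (q.cast hv hw)).Homotopic ((r.cast hu hv1).trans (s.cast hv1 hw)) := by
    rintro _ _ _ _ _ _ rfl rfl rfl _ _ rfl p q r s h
    exact h
  rw [Path.map_trans, Path.map_trans] at hm
  have hm' := e (u' := x) (v' := y) (w' := H y 1) (v1' := H x 1)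
    (by simp [f, h0]) (by simp [f, h0]) (by simp [f]) (by simp [f]) _ _ _ _ hm
  rw [← Path.Homotopic.Quotient.mk_trans, ← Path.Homotopic.Quotient.mk_trans,
    Path.Homotopic.Quotient.eq]
  convert hm' using 2
  · ext t; simp [f, a, h0]
  · ext t; simp [f, a', trackPath]
  · ext t; simp [f, c, trackPath]
  · ext t; simp [f, c', endPath]

/-- This allows compatibility of the classes with a path to be checked after the path has been
pushed to the end of the deformation, where it may lie in a single cell. -/
theorem trans_eq_of_endPath (H : C(Z, C(I, Z))) (h0 : ∀ x, H x 0 = x) {b : Z}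
    (P : ∀ x : Z, Path.Homotopic.Quotient x b)
    (htrack : ∀ x, (Path.Homotopic.Quotient.mk (trackPath H h0 x)).trans (P (H x 1)) = P x)
    {x y : Z} (γ : Path x y)
    (hγ : (Path.Homotopic.Quotient.mk (endPath H γ)).trans (P (H y 1)) = P (H x 1)) :
    (Path.Homotopic.Quotient.mk γ).trans (P y) = P x := by
  rw [← htrack y, ← Path.Homotopic.Quotient.trans_assoc, trans_trackPath H h0 γ,
    Path.Homotopic.Quotient.trans_assoc, hγ, htrack]

end PathClasses

/-! ### Polar coordinates and sectors of the disk. -/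

namespace QP

/-- The point of the disk with polar coordinates `r` and `2πx`. -/
def polar (r : I) (x : ℝ) : Disk :=
  ⟨(r : ℝ) * Complex.exp ((2 * Real.pi * x : ℝ) * Complex.I), by
    rw [mem_closedBall_zero_iff, norm_mul, Complex.norm_exp_ofReal_mul_I, mul_one,
      Complex.norm_real, Real.norm_of_nonneg r.2.1]
    exact r.2.2⟩

theorem norm_polar (r : I) (x : ℝ) : ‖(polar r x : ℂ)‖ = r := by
  simp only [polar]
  rw [norm_mul, Complex.norm_exp_ofReal_mul_I, mul_one, Complex.norm_real,
    Real.norm_of_nonneg r.2.1]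

theorem polar_one (x : ℝ) : polar 1 x = circlePoint x := by
  ext
  simp [polar, circlePoint]

theorem polar_zero (x y : ℝ) : polar 0 x = polar 0 y := by
  ext
  simp [polar]

theorem continuous_polar : Continuous fun p : I × ℝ => polar p.1 p.2 := by
  unfold polar
  fun_prop

theorem polar_add_one (r : I) (x : ℝ) : polar r (x + 1) = polar r x := by
  ext
  simp only [polar]
  congr 1
  rw [Complex.exp_eq_exp_iff_exists_int]
  exact ⟨1, by push_cast; ring⟩

theorem polar_eq_iff {r r' : I} {x y : ℝ} (h : polar r x = polar r' y) :
    r = r' ∧ (r = 0 ∨ ∃ m : ℤ, x = y + m) := by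
  have hr : r = r' := by
    ext
    rw [← norm_polar r x, ← norm_polar r' y, h]
  subst hr
  refine ⟨rfl, ?_⟩
  by_cases h0 : r = 0
  · exact Or.inl h0
  right
  have h1 := congrArg Subtype.val h
  simp only [polar] at h1
  have h2 : ((r : ℝ) : ℂ) ≠ 0 := by
    simpa using fun h => h0 (Subtype.ext h)
  have h3 := mul_left_cancel₀ h2 h1
  rw [Complex.exp_eq_exp_iff_exists_int] at h3
  obtain ⟨m, hm⟩ := h3
  refine ⟨m, ?_⟩
  have h4 : (2 * Real.pi * x : ℝ) = (2 * Real.pi * y : ℝ) + m * (2 * Real.pi) := by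
    have := congrArg Complex.im hm
    simpa using this
  have := Real.pi_pos
  field_simp at h4
  linarith

theorem exists_polar (z : Disk) : ∃ (r : I) (x : ℝ), 0 ≤ x ∧ x < 1 ∧ z = polar r x := by
  have hz : ‖(z : ℂ)‖ ≤ 1 := mem_closedBall_zero_iff.1 z.2
  refine ⟨⟨‖(z : ℂ)‖, norm_nonneg _, hz⟩, Int.fract (Complex.arg z / (2 * Real.pi)),
    Int.fract_nonneg _, Int.fract_lt_one _, ?_⟩
  ext
  simp only [polar]
  conv_lhs => rw [← Complex.norm_mul_exp_arg_mul_I z]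
  congr 1
  rw [Complex.exp_eq_exp_iff_exists_int]
  refine ⟨⌊Complex.arg z / (2 * Real.pi)⌋, ?_⟩
  have h : Complex.arg z = 2 * Real.pi * Int.fract (Complex.arg z / (2 * Real.pi)) +
      (⌊Complex.arg z / (2 * Real.pi)⌋ : ℝ) * (2 * Real.pi) := by
    have := Int.floor_add_fract (Complex.arg z / (2 * Real.pi))
    have hpi := Real.pi_pos
    have h2 : Complex.arg z = 2 * Real.pi * (Complex.arg z / (2 * Real.pi)) := by field_simp
    conv_lhs => rw [h2, ← this]
    ring
  conv_lhs => rw [h]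
  push_cast
  ring

/-- The parametrisation of the `i`-th of `l` equal sectors of the disk by radius and angle. -/
def sector (l : ℕ) (i : Fin l) (r s : I) : Disk := polar r (((i : ℕ) + (s : ℝ)) / l)

theorem sector_one (l : ℕ) (i : Fin l) (s : I) :
    sector l i 1 s = circlePoint (((i : ℕ) + (s : ℝ)) / l) := polar_one _

theorem exists_sector {l : ℕ} (hl : 0 < l) (z : Disk) : ∃ i r s, z = sector l i r s := by
  obtain ⟨r, x, hx0, hx1, rfl⟩ := exists_polar z
  have hl' : (0 : ℝ) < l := by exact_mod_cast hl
  have h1 : ⌊l * x⌋₊ < l := by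
    rw [Nat.floor_lt (by positivity)]
    nlinarith
  refine ⟨⟨⌊l * x⌋₊, h1⟩, r, ⟨l * x - ⌊l * x⌋₊, ?_, ?_⟩, ?_⟩
  · linarith [Nat.floor_le (show 0 ≤ l * x by positivity)]
  · linarith [Nat.lt_floor_add_one (l * x)]
  · unfold sector
    congr 1
    field_simp
    ring

/-- The index after `i` in cyclic order. -/
def cycSucc {l : ℕ} (i : Fin l) : Fin l := ⟨(i + 1) % l, Nat.mod_lt _ i.pos⟩

theorem sector_eq {l : ℕ} {i j : Fin l} {r r' s s' : I} (h : sector l i r s = sector l j r' s') :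
    r = r' ∧ (r = 0 ∨ (i = j ∧ s = s') ∨ (j = cycSucc i ∧ s = 1 ∧ s' = 0) ∨
      (i = cycSucc j ∧ s' = 1 ∧ s = 0)) := by
  obtain ⟨hr, h⟩ := polar_eq_iff h
  refine ⟨hr, h.imp_right ?_⟩
  rintro ⟨m, hm⟩
  have hl' : (0 : ℝ) < l := by exact_mod_cast i.pos
  field_simp at hm
  have hi : ((i : ℕ) : ℝ) + 1 ≤ l := by exact_mod_cast i.2
  have hj : ((j : ℕ) : ℝ) + 1 ≤ l := by exact_mod_cast j.2
  have hi0 : (0 : ℝ) ≤ (i : ℕ) := by positivity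
  have hj0 : (0 : ℝ) ≤ (j : ℕ) := by positivity
  have hs0 := s.2.1
  have hs1 := s.2.2
  have hs0' := s'.2.1
  have hs1' := s'.2.2
  -- Both angles lie in `[0, 1]` as fractions of a full turn, so they differ by `-1`, `0` or `1`;
  -- the values `±1` occur only on the ray between the last and the first sector.
  have hm1 : -1 ≤ m := by
    by_contra hcon
    have : (m : ℝ) ≤ -2 := by exact_mod_cast (by omega : m ≤ -2)
    nlinarith
  have hm2 : m ≤ 1 := by
    by_contra hcon
    have : (2 : ℝ) ≤ m := by exact_mod_cast (by omega : 2 ≤ m)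
    nlinarith
  have hone : ∀ u : I, 1 ≤ (u : ℝ) → u = 1 := fun u hu => Subtype.ext (le_antisymm u.2.2 hu)
  have hnull : ∀ u : I, (u : ℝ) ≤ 0 → u = 0 := fun u hu => Subtype.ext (le_antisymm hu u.2.1)
  have hlast : ∀ k : Fin l, (l : ℝ) ≤ (k : ℕ) + 1 → (k : ℕ) + 1 = l := fun k hk => by
    have h1 : l ≤ (k : ℕ) + 1 := by exact_mod_cast hk
    have := k.2
    omega
  have hzero : ∀ k : Fin l, ((k : ℕ) : ℝ) ≤ 0 → (k : ℕ) = 0 := fun k hk => by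
    have h1 : (k : ℕ) ≤ 0 := by exact_mod_cast hk
    omega
  obtain rfl | rfl | rfl : m = -1 ∨ m = 0 ∨ m = 1 := by omega
  · push_cast at hm
    right; right
    refine ⟨?_, hone _ (by linarith), hnull _ (by linarith)⟩
    · have h1 := hlast j (by linarith)
      have h2 := hzero i (by linarith)
      ext
      simp [cycSucc, h1, h2]
  · push_cast at hm
    rcases lt_trichotomy (i : ℕ) j with h1 | h1 | h1
    · have h2 : ((i : ℕ) : ℝ) + 1 ≤ (j : ℕ) := by exact_mod_cast h1
      right; left
      refine ⟨?_, hone _ (by linarith), hnull _ (by linarith)⟩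
      have h3 : ((j : ℕ) : ℝ) = ((i + 1 : ℕ) : ℝ) := by push_cast; linarith
      have h4 : (j : ℕ) = i + 1 := by exact_mod_cast h3
      ext
      simp only [cycSucc]
      rw [← h4, Nat.mod_eq_of_lt j.2]
    · left
      exact ⟨Fin.ext h1, Subtype.ext (by rw [h1] at hm; linarith)⟩
    · have h2 : ((j : ℕ) : ℝ) + 1 ≤ (i : ℕ) := by exact_mod_cast h1
      right; right
      refine ⟨?_, hone _ (by linarith), hnull _ (by linarith)⟩
      have h3 : ((i : ℕ) : ℝ) = ((j + 1 : ℕ) : ℝ) := by push_cast; linarith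
      have h4 : (i : ℕ) = j + 1 := by exact_mod_cast h3
      ext
      simp only [cycSucc]
      rw [← h4, Nat.mod_eq_of_lt i.2]
  · push_cast at hm
    right; left
    refine ⟨?_, hone _ (by linarith), hnull _ (by linarith)⟩
    · have h1 := hlast i (by linarith)
      have h2 := hzero j (by linarith)
      ext
      simp [cycSucc, h1, h2]

theorem sector_cycSucc {l : ℕ} (i : Fin l) (r : I) :
    sector l (cycSucc i) r 0 = sector l i r 1 := by
  have hl' : (l : ℝ) ≠ 0 := by exact_mod_cast i.pos.ne'
  unfold sector cycSucc
  rcases Nat.lt_or_ge ((i : ℕ) + 1) l with h | h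
  · simp [Nat.mod_eq_of_lt h]
  · have h1 : (i : ℕ) + 1 = l := by have := i.2; omega
    have h2 : ((i : ℕ) : ℝ) + 1 = l := by exact_mod_cast h1
    simp only [h1, Nat.mod_self, Nat.cast_zero, Set.Icc.coe_zero, Set.Icc.coe_one, h2, add_zero,
      zero_div, div_self hl']
    have := polar_add_one r 0
    rw [zero_add] at this
    exact this.symm

theorem sector_zero {l : ℕ} (i j : Fin l) (s s' : I) : sector l i 0 s = sector l j 0 s' :=
  polar_zero _ _

theorem continuous_sector (l : ℕ) :
    Continuous fun p : Fin l × I × I => sector l p.1 p.2.1 p.2.2 := by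
  refine continuous_polar.comp (Continuous.prodMk (by fun_prop) ?_)
  refine Continuous.div_const (Continuous.add ?_ (by fun_prop)) _
  exact (continuous_of_discreteTopology (f := fun i : Fin l => ((i : ℕ) : ℝ))).comp continuous_fst

/-- Continuous maps on the disk can be defined sector by sector. -/
theorem exists_disk_map {T : Type*} [TopologicalSpace T] {l : ℕ} (hl : 0 < l)
    (f : Fin l → I → I → T) (hf : ∀ i, Continuous fun p : I × I => f i p.1 p.2)
    (hsucc : ∀ i r, f i r 1 = f (cycSucc i) r 0) (hzero : ∀ i j s s', f i 0 s = f j 0 s') :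
    ∃ F : C(Disk, T), ∀ i r s, F (sector l i r s) = f i r s := by
  have : T2Space Disk := inferInstance
  let q : C(Fin l × I × I, Disk) := ⟨_, continuous_sector l⟩
  have hq : Topology.IsQuotientMap q := by
    -- A continuous surjection from a compact space onto a Hausdorff space is a quotient map.
    refine Topology.IsQuotientMap.of_surjective_continuous ?_ q.continuous
    intro z
    obtain ⟨i, r, s, rfl⟩ := exists_sector hl z
    exact ⟨(i, r, s), rfl⟩
  let f' : C(Fin l × I × I, T) := ⟨fun p => f p.1 p.2.1 p.2.2, by
    refine continuous_iff_continuousAt.2 fun ⟨i, p⟩ => ?_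
    have h1 : ContinuousAt (fun q : Fin l × I × I => f i q.2.1 q.2.2) (i, p) :=
      ((hf i).comp continuous_snd).continuousAt
    refine h1.congr ?_
    have h2 : {q : Fin l × I × I | q.1 = i} ∈ nhds (i, p) :=
      (continuous_fst.isOpen_preimage {i} (isOpen_discrete _)).mem_nhds rfl
    filter_upwards [h2] with q hq
    rw [show q.1 = i from hq]⟩
  have hfac : Function.FactorsThrough f' q := by
    rintro ⟨i, r, s⟩ ⟨j, r', s'⟩ h
    replace h : sector l i r s = sector l j r' s' := h
    change f i r s = f j r' s'
    obtain ⟨hr, h'⟩ := sector_eq h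
    clear h
    subst hr
    rcases h' with rfl | ⟨rfl, rfl⟩ | ⟨rfl, rfl, rfl⟩ | ⟨rfl, rfl, rfl⟩
    · exact hzero _ _ _ _
    · rfl
    · exact hsucc _ _
    · exact (hsucc _ _).symm
  refine ⟨hq.lift f' hfac, fun i r s => ?_⟩
  exact DFunLike.congr_fun (hq.lift_comp f' hfac) (i, r, s)

end QP

theorem RepQuiver.IsCycle.tgt_get {V A : Type*} {Q : RepQuiver V A} {l : List A}
    (h : Q.IsCycle (l : Cycle A)) (i : Fin l.length) :
    Q.tgt (l.get i) = Q.src (l.get (QP.cycSucc i)) := by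
  unfold RepQuiver.IsCycle at h
  cases l with
  | nil => exact i.elim0
  | cons a m =>
    rw [Cycle.chain_coe_cons, List.isChain_iff_getElem] at h
    have h0 : (i : ℕ) < m.length + 1 := i.2
    have h1 := h i (by simp; omega)
    have h2 : (a :: (m ++ [a]))[(i : ℕ)]'(by simp) = (a :: m).get i :=
      List.getElem_append_left (as := a :: m) (bs := [a]) i.2
    rw [← h2, h1]
    congr 1
    rcases Nat.lt_or_ge ((i : ℕ) + 1) (m.length + 1) with h3 | h3
    · simp only [QP.cycSucc, List.get_eq_getElem, List.length_cons, Nat.mod_eq_of_lt h3]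
      exact List.getElem_append_left (as := a :: m) (bs := [a]) h3
    · have h4 : (i : ℕ) = m.length := by omega
      simp [QP.cycSucc, h4]

/-! ### Cells of the canvas and continuous maps out of it. -/

namespace QP

variable {k V A : Type*} [Field k] (X : QP k V A)

theorem Face.coe_word {X : QP k V A} (c : X.Face) : (c.word : Cycle A) = c.1 :=
  Quotient.out_eq (s := List.IsRotated.setoid A) c.1

theorem Face.three_le {X : QP k V A} (c : X.Face) : 3 ≤ c.word.length := by
  have := X.three_le c.1 c.2
  rwa [← c.coe_word] at this

theorem Face.length_pos {X : QP k V A} (c : X.Face) : 0 < c.word.length := by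
  have := c.three_le
  omega

theorem Face.tgt_get {X : QP k V A} (c : X.Face) (i : Fin c.word.length) :
    X.tgt (c.word.get i) = X.src (c.word.get (cycSucc i)) := by
  have := X.isCycle c.1 c.2
  rw [← c.coe_word] at this
  exact this.tgt_get i

theorem edgePt_zero (a : A) : X.edgePt a 0 = X.vertexPt (X.src a) := Quot.sound (.start a)

theorem edgePt_one (a : A) : X.edgePt a 1 = X.vertexPt (X.tgt a) := Quot.sound (.finish a)

theorem facePt_circlePoint (c : X.Face) (i : Fin c.word.length) (t : I) :
    X.facePt c (circlePoint (((i : ℕ) + (t : ℝ)) / c.word.length)) = X.edgePt (c.word.get i) t :=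
  Quot.sound (.face c i t)

theorem facePt_sector_one (c : X.Face) (i : Fin c.word.length) (t : I) :
    X.facePt c (sector _ i 1 t) = X.edgePt (c.word.get i) t := by
  rw [sector_one, facePt_circlePoint]

theorem continuous_edgePt (a : A) : Continuous (X.edgePt a) :=
  continuous_quot_mk.comp (continuous_inr.comp (continuous_inl.comp continuous_sigmaMk))

theorem continuous_facePt (c : X.Face) : Continuous (X.facePt c) :=
  continuous_quot_mk.comp (continuous_inr.comp (continuous_inr.comp continuous_sigmaMk))

theorem canvas_cases {p : X.Canvas → Prop} (hV : ∀ v, p (X.vertexPt v))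
    (hA : ∀ a t, p (X.edgePt a t)) (hF : ∀ c i r s, p (X.facePt c (sector c.word.length i r s)))
    (x : X.Canvas) : p x := by
  induction x using Quot.ind with | mk x =>
  rcases x with ⟨v, ⟨⟩⟩ | ⟨a, t⟩ | ⟨c, z⟩
  · exact hV v
  · exact hA a t
  · obtain ⟨i, r, s, rfl⟩ := exists_sector c.length_pos z
    exact hF c i r s

/-- Continuous maps on the canvas can be defined on vertices, edges and sectors of faces. -/
theorem exists_canvas_map {T : Type*} [TopologicalSpace T] (fV : V → T) (fA : A → I → T)
    (fF : ∀ c : X.Face, Fin c.word.length → I → I → T)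
    (hA : ∀ a, Continuous (fA a))
    (hF : ∀ c i, Continuous fun p : I × I => fF c i p.1 p.2)
    (hsrc : ∀ a, fA a 0 = fV (X.src a)) (htgt : ∀ a, fA a 1 = fV (X.tgt a))
    (hone : ∀ c i s, fF c i 1 s = fA (c.word.get i) s)
    (hsucc : ∀ c i r, fF c i r 1 = fF c (cycSucc i) r 0)
    (hzero : ∀ c i j s s', fF c i 0 s = fF c j 0 s') :
    ∃ F : C(X.Canvas, T), (∀ v, F (X.vertexPt v) = fV v) ∧ (∀ a t, F (X.edgePt a t) = fA a t) ∧
      ∀ c i r s, F (X.facePt c (sector _ i r s)) = fF c i r s := by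
  choose D hD using fun c : X.Face =>
    exists_disk_map c.length_pos (fF c) (hF c) (hsucc c) (hzero c)
  let F₀ : X.PreCanvas → T :=
    Sum.elim (fun v => fV v.1) (Sum.elim (fun a => fA a.1 a.2) (fun c => D c.1 c.2))
  have hF₀ : Continuous F₀ := by
    refine Continuous.sumElim ?_ (Continuous.sumElim ?_ ?_)
    · exact continuous_sigma fun v => @continuous_const _ _ _ _ (fV v)
    · exact continuous_sigma fun a => hA a
    · exact continuous_sigma fun c => (D c).continuous
  have hg : ∀ x y, X.Glue x y → F₀ x = F₀ y := by
    rintro _ _ (a | a | ⟨c, i, t⟩)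
    · exact hsrc a
    · exact htgt a
    · change D c _ = fA _ t
      rw [← sector_one, hD, hone]
  exact ⟨⟨Quot.lift F₀ hg, continuous_quot_lift hg hF₀⟩, fun _ => rfl, fun _ _ => rfl,
    fun c i r s => hD c i r s⟩

end QP

/-! ### Lifts of maps to classes of paths. -/

section PathLift

variable {Z : Type*} [TopologicalSpace Z] {b : Z} {T T' : Type*} [TopologicalSpace T]
  [TopologicalSpace T']

/-- A lift of a map `f` to the set of homotopy classes of paths that end in the base point `b`,
which is compatible with the images of all paths under `f`. -/
def IsPathLift (f : C(T, Z)) (φ : T → Σ x : Z, Path.Homotopic.Quotient x b) : Prop :=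
  ∃ L : ∀ t, Path.Homotopic.Quotient (f t) b, (∀ t, φ t = ⟨f t, L t⟩) ∧
    ∀ (s t : T) (γ : Path s t),
      (Path.Homotopic.Quotient.mk (γ.map f.continuous)).trans (L t) = L s

namespace IsPathLift

theorem fst {f : C(T, Z)} {φ : T → Σ x : Z, Path.Homotopic.Quotient x b} (h : IsPathLift f φ)
    (t : T) : (φ t).1 = f t := by
  obtain ⟨L, hL, -⟩ := h
  rw [hL]

theorem comp {f : C(T, Z)} {φ : T → Σ x : Z, Path.Homotopic.Quotient x b} (h : IsPathLift f φ)
    (g : C(T', T)) : IsPathLift (f.comp g) (φ ∘ g) := by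
  obtain ⟨L, hL, h⟩ := h
  exact ⟨fun t => L (g t), fun t => hL (g t), fun s t γ => h _ _ (γ.map g.continuous)⟩

/-- The value at `t` determines the value at `s` by transport along any path from `s` to `t`. -/
theorem unique [PathConnectedSpace T] {f : C(T, Z)}
    {φ ψ : T → Σ x : Z, Path.Homotopic.Quotient x b} (hφ : IsPathLift f φ) (hψ : IsPathLift f ψ)
    {t : T} (ht : φ t = ψ t) : φ = ψ := by
  obtain ⟨L, hL, h⟩ := hφ
  obtain ⟨M, hM, h'⟩ := hψ
  funext s
  have h1 : L t = M t := by
    rw [hL, hM] at ht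
    exact eq_of_heq (Sigma.mk.inj ht).2
  rw [hL, hM, ← h s t (PathConnectedSpace.somePath s t),
    ← h' s t (PathConnectedSpace.somePath s t), h1]

/-- Transport the prescribed class along a path in `T`; the result does not depend on the path
because `T` is simply connected. -/
theorem exists_of_eq [SimplyConnectedSpace T] (f : C(T, Z)) (t : T)
    (e : Σ x : Z, Path.Homotopic.Quotient x b) (he : e.1 = f t) :
    ∃ φ, IsPathLift f φ ∧ φ t = e := by
  obtain ⟨x, q⟩ := e
  obtain rfl : x = f t := he
  refine ⟨fun s => ⟨f s, (Path.Homotopic.Quotient.mk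
    ((PathConnectedSpace.somePath s t).map f.continuous)).trans q⟩, ⟨_, fun s => rfl, ?_⟩, ?_⟩
  · intro s s' γ
    rw [← Path.Homotopic.Quotient.trans_assoc, ← Path.Homotopic.Quotient.mk_trans,
      ← Path.map_trans]
    congr 1
    rw [Path.Homotopic.Quotient.eq]
    exact (SimplyConnectedSpace.paths_homotopic _ _).map f
  · have : Path.Homotopic.Quotient.mk ((PathConnectedSpace.somePath t t).map f.continuous) =
        Path.Homotopic.Quotient.refl (f t) := by
      rw [← Path.Homotopic.Quotient.mk_refl, Path.Homotopic.Quotient.eq]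
      exact (SimplyConnectedSpace.paths_homotopic _ (Path.refl t)).map f
    simp only [this]
    simp

end IsPathLift

end PathLift

namespace QP

instance : ContractibleSpace Disk :=
  (convex_closedBall (0 : ℂ) 1).contractibleSpace ⟨0, by simp⟩

variable {k V A : Type*} [Field k] (X : QP k V A)

/-- The characteristic map of an edge as a continuous map. -/
def edgeMap (a : A) : C(I, X.Canvas) := ⟨X.edgePt a, X.continuous_edgePt a⟩

/-- The characteristic map of a face as a continuous map. -/
def faceMap (c : X.Face) : C(Disk, X.Canvas) := ⟨X.facePt c, X.continuous_facePt c⟩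

/-- The parametrisation of the `i`-th arc of the boundary of the disk. -/
def arcMap (l : ℕ) (i : Fin l) : C(I, Disk) :=
  ⟨fun t => sector l i 1 t, by
    have h : Continuous fun t : I => (i, (1 : I), t) := by fun_prop
    exact (continuous_sector l).comp h⟩

theorem faceMap_comp_arcMap (c : X.Face) (i : Fin c.word.length) :
    (X.faceMap c).comp (arcMap _ i) = X.edgeMap (c.word.get i) := by
  ext t
  exact X.facePt_sector_one c i t

/-- A lift which is given on the vertices extends to the canvas as soon as it extends to every
edge. -/
theorem exists_lift_of_edges {b : X.Canvas} (e : V → Σ x : X.Canvas, Path.Homotopic.Quotient x b)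
    (he : ∀ v, (e v).1 = X.vertexPt v)
    (hedge : ∀ a, ∃ φ, IsPathLift (X.edgeMap a) φ ∧ φ 0 = e (X.src a) ∧ φ 1 = e (X.tgt a)) :
    ∃ Φ : X.Canvas → Σ x : X.Canvas, Path.Homotopic.Quotient x b,
      (∀ x, (Φ x).1 = x) ∧ (∀ a, IsPathLift (X.edgeMap a) (Φ ∘ X.edgePt a)) ∧
        ∀ c, IsPathLift (X.faceMap c) (Φ ∘ X.facePt c) := by
  choose φA hA hA0 hA1 using hedge
  -- Over a disk a lift is determined by its value at one point, here the start of the boundary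
  -- word.
  have hF : ∀ c : X.Face, ∃ φ, IsPathLift (X.faceMap c) φ ∧
      φ (sector _ ⟨0, c.length_pos⟩ 1 0) = e (X.src (c.word.get ⟨0, c.length_pos⟩)) := fun c => by
    refine IsPathLift.exists_of_eq _ _ _ ?_
    rw [he, ← X.edgePt_zero, ← X.facePt_sector_one]
    rfl
  choose φF hF hF0 using hF
  -- Uniqueness over each boundary arc carries the agreement from one corner to the next. Closing up
  -- after the last arc needs no check, since the lift is already defined on the whole disk.
  have key : ∀ (c : X.Face) (n : ℕ) (hn : n < c.word.length),
      φF c (sector _ ⟨n, hn⟩ 1 0) = e (X.src (c.word.get ⟨n, hn⟩)) := by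
    intro c n
    induction n with
    | zero => exact fun _ => hF0 c
    | succ n ih =>
      intro hn
      have hn' : n < c.word.length := by omega
      have h1 : (⟨n + 1, hn⟩ : Fin c.word.length) = cycSucc ⟨n, hn'⟩ := by
        ext
        simp [cycSucc, Nat.mod_eq_of_lt hn]
      have h2 := (hF c).comp (arcMap _ ⟨n, hn'⟩)
      rw [faceMap_comp_arcMap] at h2
      have h3 := h2.unique (hA _) (t := 0) (by rw [hA0, ← ih hn']; rfl)
      rw [h1, sector_cycSucc, ← c.tgt_get, ← hA1, ← h3]
      rfl
  have key' : ∀ (c : X.Face) (i : Fin c.word.length) (t : I),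
      φF c (sector _ i 1 t) = φA (c.word.get i) t := by
    intro c i t
    have h2 := (hF c).comp (arcMap _ i)
    rw [faceMap_comp_arcMap] at h2
    have h3 := h2.unique (hA _) (t := 0) (by rw [hA0, ← key c i i.2]; rfl)
    rw [← h3]
    rfl
  let Φ₀ : X.PreCanvas → Σ x : X.Canvas, Path.Homotopic.Quotient x b :=
    Sum.elim (fun v => e v.1) (Sum.elim (fun a => φA a.1 a.2) (fun c => φF c.1 c.2))
  have hg : ∀ x y, X.Glue x y → Φ₀ x = Φ₀ y := by
    rintro _ _ (a | a | ⟨c, i, t⟩)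
    · exact hA0 a
    · exact hA1 a
    · change φF c _ = φA _ t
      rw [← sector_one, key']
  refine ⟨Quot.lift Φ₀ hg, ?_, hA, hF⟩
  intro x
  induction x using Quot.ind with | mk x =>
  rcases x with ⟨v, ⟨⟩⟩ | ⟨a, t⟩ | ⟨c, z⟩
  · exact he v
  · exact (hA a).fst t
  · exact (hF c).fst z

end QP

/-! ### A deformation of the canvas and neighbourhoods of its cells. -/

/-- The homotopy of the interval, in the second variable, from the identity to the map which
collapses the two outer quarters. -/
def squeeze (s τ : I) : I :=
  Set.Icc.convexComb s (Set.projIcc (0 : ℝ) 1 zero_le_one (2 * s - 1 / 2)) τ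

/-- The homotopy of the interval, in the second variable, from the identity to the map which
collapses the upper half. -/
def expand (r τ : I) : I :=
  Set.Icc.convexComb r (Set.projIcc (0 : ℝ) 1 zero_le_one (2 * r)) τ

theorem continuous_squeeze : Continuous fun p : I × I => squeeze p.1 p.2 := by
  have h : Continuous fun p : I × I =>
      (p.1, Set.projIcc (0 : ℝ) 1 zero_le_one (2 * p.1 - 1 / 2), p.2) :=
    Continuous.prodMk (by fun_prop)
      (Continuous.prodMk (continuous_projIcc.comp (by fun_prop)) (by fun_prop))
  exact Set.Icc.continuous_convexComb_prod.comp h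

theorem continuous_expand : Continuous fun p : I × I => expand p.1 p.2 := by
  have h : Continuous fun p : I × I =>
      (p.1, Set.projIcc (0 : ℝ) 1 zero_le_one (2 * p.1), p.2) :=
    Continuous.prodMk (by fun_prop)
      (Continuous.prodMk (continuous_projIcc.comp (by fun_prop)) (by fun_prop))
  exact Set.Icc.continuous_convexComb_prod.comp h

@[simp] theorem squeeze_at_zero (s : I) : squeeze s 0 = s := by simp [squeeze]

@[simp] theorem expand_at_zero (s : I) : expand s 0 = s := by simp [expand]

theorem squeeze_eq_zero {s : I} (hs : (s : ℝ) ≤ 1 / 4) : squeeze s 1 = 0 := by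
  simp only [squeeze, Set.Icc.convexComb_one]
  exact Set.projIcc_of_le_left _ (by linarith)

theorem squeeze_eq_one {s : I} (hs : 3 / 4 ≤ (s : ℝ)) : squeeze s 1 = 1 := by
  simp only [squeeze, Set.Icc.convexComb_one]
  exact Set.projIcc_of_right_le _ (by linarith)

theorem expand_eq_one {s : I} (hs : 1 / 2 ≤ (s : ℝ)) : expand s 1 = 1 := by
  simp only [expand, Set.Icc.convexComb_one]
  exact Set.projIcc_of_right_le _ (by linarith)

theorem squeeze_zero_left (τ : I) : squeeze 0 τ = 0 := by
  rw [squeeze, Set.projIcc_of_le_left _ (by norm_num)]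
  exact Set.Icc.convexComb_eq _ _

theorem squeeze_one_left (τ : I) : squeeze 1 τ = 1 := by
  rw [squeeze, Set.projIcc_of_right_le _ (by norm_num)]
  exact Set.Icc.convexComb_eq _ _

theorem expand_zero_left (τ : I) : expand 0 τ = 0 := by
  rw [expand, Set.projIcc_of_le_left _ (by norm_num)]
  exact Set.Icc.convexComb_eq _ _

theorem expand_one_left (τ : I) : expand 1 τ = 1 := by
  rw [expand, Set.projIcc_of_right_le _ (by norm_num)]
  exact Set.Icc.convexComb_eq _ _

namespace QP

variable {k V A : Type*} [Field k] (X : QP k V A)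

/-- The canvas can be deformed, along its cells, to a map that collapses neighbourhoods of the
vertices and maps the outer parts of the faces to the edges. -/
theorem exists_deformation : ∃ H : C(X.Canvas, C(I, X.Canvas)),
    (∀ v τ, H (X.vertexPt v) τ = X.vertexPt v) ∧
    (∀ a s τ, H (X.edgePt a s) τ = X.edgePt a (squeeze s τ)) ∧
    ∀ c i r s τ, H (X.facePt c (sector c.word.length i r s)) τ =
      X.facePt c (sector _ i (expand r τ) (squeeze s τ)) := by
  have hA : ∀ a, Continuous fun p : I × I => X.edgePt a (squeeze p.1 p.2) := fun a =>
    (X.continuous_edgePt a).comp continuous_squeeze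
  have hF : ∀ (c : X.Face) (i : Fin c.word.length), Continuous fun p : (I × I) × I =>
      X.facePt c (sector _ i (expand p.1.1 p.2) (squeeze p.1.2 p.2)) := fun c i => by
    have h : Continuous fun p : (I × I) × I => (i, expand p.1.1 p.2, squeeze p.1.2 p.2) :=
      Continuous.prodMk continuous_const (Continuous.prodMk
        (continuous_expand.comp (by fun_prop : Continuous fun p : (I × I) × I => (p.1.1, p.2)))
        (continuous_squeeze.comp (by fun_prop : Continuous fun p : (I × I) × I => (p.1.2, p.2))))
    exact (X.continuous_facePt c).comp ((continuous_sector _).comp h)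
  obtain ⟨H, hHV, hHA, hHF⟩ := X.exists_canvas_map (T := C(I, X.Canvas))
    (fun v => ContinuousMap.const I (X.vertexPt v))
    (fun a s => ContinuousMap.curry ⟨_, hA a⟩ s)
    (fun c i r s => ContinuousMap.curry ⟨_, hF c i⟩ (r, s))
    (fun a => ContinuousMap.continuous _)
    (fun c i => ContinuousMap.continuous _)
    (fun a => by ext τ; simp [squeeze_zero_left, edgePt_zero])
    (fun a => by ext τ; simp [squeeze_one_left, edgePt_one])
    (fun c i s => by
      ext τ
      simp only [ContinuousMap.curry_apply, ContinuousMap.coe_mk, expand_one_left]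
      exact X.facePt_sector_one c i _)
    (fun c i r => by
      ext τ
      simp only [ContinuousMap.curry_apply, ContinuousMap.coe_mk, squeeze_one_left, squeeze_zero_left,
        sector_cycSucc])
    (fun c i j s s' => by
      ext τ
      simp only [ContinuousMap.curry_apply, ContinuousMap.coe_mk, expand_zero_left]
      rw [sector_zero i j])
  exact ⟨H, fun v τ => by rw [hHV]; rfl, fun a s τ => by rw [hHA]; rfl,
    fun c i r s τ => by rw [hHF]; rfl⟩

/-- Every vertex has an open neighbourhood which the deformation collapses to the vertex. -/
theorem exists_vertex_nhd (H : C(X.Canvas, C(I, X.Canvas)))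
    (hV : ∀ v τ, H (X.vertexPt v) τ = X.vertexPt v)
    (hA : ∀ a s τ, H (X.edgePt a s) τ = X.edgePt a (squeeze s τ))
    (hF : ∀ c i r s τ, H (X.facePt c (sector c.word.length i r s)) τ =
      X.facePt c (sector _ i (expand r τ) (squeeze s τ))) (v : V) :
    ∃ U : Set X.Canvas, IsOpen U ∧ X.vertexPt v ∈ U ∧ ∀ x ∈ U, H x 1 = X.vertexPt v := by
  -- Closeness to the ends that lie at `v`; the maximum takes care of loops. On a face it is scaled
  -- by the radius. A value above `3/4` then forces `s` into an outer quarter, which `squeeze`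
  -- collapses, and the radius above `1/2`, where `expand` reaches the edge.
  let fA : A → I → ℝ := fun a s =>
    max (if X.src a = v then 1 - (s : ℝ) else 0) (if X.tgt a = v then (s : ℝ) else 0)
  have hfA : ∀ a s, 3 / 4 < fA a s → X.edgePt a (squeeze s 1) = X.vertexPt v := by
    intro a s h
    rcases lt_max_iff.1 h with h | h
    · split_ifs at h with h1
      · rw [squeeze_eq_zero (by linarith), edgePt_zero, h1]
      · norm_num at h
    · split_ifs at h with h1
      · rw [squeeze_eq_one h.le, edgePt_one, h1]
      · norm_num at h
  have hfc : ∀ a, Continuous (fA a) := fun a => by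
    refine Continuous.max ?_ ?_ <;> split_ifs <;> fun_prop
  have hf0 : ∀ a, fA a 0 = if X.src a = v then 1 else 0 := fun a => by
    simp only [fA]
    split_ifs <;> simp
  have hf1 : ∀ a, fA a 1 = if X.tgt a = v then 1 else 0 := fun a => by
    simp only [fA]
    split_ifs <;> simp
  have hfle : ∀ a s, fA a s ≤ 1 := fun a s => by
    have := s.2.1
    have := s.2.2
    refine max_le ?_ ?_ <;> split_ifs <;> linarith
  obtain ⟨F, hFV, hFA, hFF⟩ := X.exists_canvas_map (T := ℝ) (fun w => if w = v then 1 else 0) fA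
    (fun c i r s => r * fA (c.word.get i) s) hfc
    (fun c i => by
      have := hfc (c.word.get i)
      fun_prop)
    hf0 hf1 (fun c i s => by simp) (fun c i r => by rw [hf1, hf0, c.tgt_get])
    (fun c i j s s' => by simp)
  refine ⟨F ⁻¹' Set.Ioi (3 / 4), isOpen_Ioi.preimage F.continuous, ?_, ?_⟩
  · change 3 / 4 < F _
    rw [hFV, if_pos rfl]
    norm_num
  · intro x hx
    change 3 / 4 < F x at hx
    induction x using X.canvas_cases with
    | hV w =>
      rw [hFV] at hx
      split_ifs at hx with h
      · rw [hV, h]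
      · norm_num at hx
    | hA a s =>
      rw [hFA] at hx
      rw [hA, hfA a s hx]
    | hF c i r s =>
      rw [hFF] at hx
      have h1 := hfle (c.word.get i) s
      have h2 := r.2.1
      have h3 := r.2.2
      have h4 : 0 ≤ fA (c.word.get i) s := by
        by_contra h
        nlinarith
      rw [hF, expand_eq_one (by nlinarith), facePt_sector_one]
      exact hfA _ _ (by nlinarith)

/-- The interior of an edge has an open neighbourhood which the deformation maps to the edge. -/
theorem exists_edge_nhd (H : C(X.Canvas, C(I, X.Canvas)))
    (hA : ∀ a s τ, H (X.edgePt a s) τ = X.edgePt a (squeeze s τ))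
    (hF : ∀ c i r s τ, H (X.facePt c (sector c.word.length i r s)) τ =
      X.facePt c (sector _ i (expand r τ) (squeeze s τ))) (a : A) :
    ∃ (U : Set X.Canvas) (d : X.Canvas → I), IsOpen U ∧ ContinuousOn d U ∧
      (∀ s : I, 0 < (s : ℝ) → (s : ℝ) < 1 → X.edgePt a s ∈ U) ∧
      ∀ x ∈ U, H x 1 = X.edgePt a (d x) := by
  -- The coordinate `s` need not extend continuously over the end points, but `h` and `m = s * h`
  -- do, because `h` vanishes at both ends. Where `F` is positive the quotient `M / F` recovers `s`.
  -- On faces both are multiplied by a factor that cancels in the quotient and vanishes for radius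
  -- at most `1/2`.
  let h : A → I → ℝ := fun a' s => if a' = a then min (s : ℝ) (1 - s) else 0
  let m : A → I → ℝ := fun a' s => s * h a' s
  have hc : ∀ a', Continuous (h a') := fun a' => by
    simp only [h]
    split_ifs <;> fun_prop
  have mc : ∀ a', Continuous (m a') := fun a' => by
    have := hc a'
    fun_prop
  have h0 : ∀ a', h a' 0 = 0 := fun a' => by simp [h]
  have h1 : ∀ a', h a' 1 = 0 := fun a' => by simp [h]
  obtain ⟨F, hFV, hFA, hFF⟩ := X.exists_canvas_map (T := ℝ) (fun w => 0) h
    (fun c i r s => max 0 (2 * (r : ℝ) - 1) * h (c.word.get i) s) hc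
    (fun c i => by
      have := hc (c.word.get i)
      fun_prop)
    h0 h1 (fun c i s => by norm_num) (fun c i r => by rw [h1, h0])
    (fun c i j s s' => by norm_num)
  obtain ⟨M, hMV, hMA, hMF⟩ := X.exists_canvas_map (T := ℝ) (fun w => 0) m
    (fun c i r s => max 0 (2 * (r : ℝ) - 1) * m (c.word.get i) s) mc
    (fun c i => by
      have := mc (c.word.get i)
      fun_prop)
    (fun a' => by simp [m]) (fun a' => by simp [m, h1]) (fun c i s => by norm_num)
    (fun c i r => by simp [m, h1])
    (fun c i j s s' => by norm_num)
  refine ⟨F ⁻¹' Set.Ioi 0, fun x => squeeze (Set.projIcc (0 : ℝ) 1 zero_le_one (M x / F x)) 1,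
    isOpen_Ioi.preimage F.continuous, ?_, ?_, ?_⟩
  · have hd : ContinuousOn (fun x => M x / F x) (F ⁻¹' Set.Ioi 0) :=
      M.continuous.continuousOn.div F.continuous.continuousOn fun x hx => ne_of_gt hx
    have hs : Continuous fun s : I => squeeze s 1 :=
      continuous_squeeze.comp (by fun_prop : Continuous fun s : I => (s, (1 : I)))
    exact hs.comp_continuousOn (continuous_projIcc.comp_continuousOn hd)
  · intro s hs hs'
    change 0 < F _
    rw [hFA]
    simp only [h, if_pos]
    exact lt_min hs (by linarith)
  · intro x hx
    change 0 < F x at hx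
    induction x using X.canvas_cases with
    | hV w =>
      rw [hFV] at hx
      exact absurd hx (lt_irrefl _)
    | hA a' s =>
      rw [hFA] at hx
      have ha : a' = a := by
        by_contra ha
        simp [h, ha] at hx
      subst ha
      rw [hA]
      simp only [hFA, hMA]
      simp only [m]
      rw [mul_div_cancel_right₀ _ hx.ne', Set.projIcc_val]
    | hF c i r s =>
      rw [hFF] at hx
      have ha : c.word.get i = a := by
        by_contra ha
        simp only [h, if_neg ha] at hx
        simp at hx
      have hr : 1 / 2 ≤ (r : ℝ) := by
        by_contra hr
        rw [max_eq_left (by linarith)] at hx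
        simp at hx
      rw [hF, expand_eq_one hr, facePt_sector_one]
      simp only [hFF, hMF, ha]
      rw [ha] at hx
      simp only [m]
      rw [← mul_assoc, mul_comm _ (s : ℝ), mul_assoc, mul_div_cancel_right₀ _ hx.ne',
        Set.projIcc_val]

/-- The interior of a face is open, and the inverse of its characteristic map is continuous. -/
theorem exists_face_nhd (c : X.Face) :
    ∃ (U : Set X.Canvas) (d : X.Canvas → ℂ), IsOpen U ∧ ContinuousOn d U ∧
      (∀ (i : Fin c.word.length) (r s : I), (r : ℝ) < 1 → X.facePt c (sector c.word.length i r s) ∈ U) ∧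
      ∀ x ∈ U, ∃ h : d x ∈ Metric.closedBall (0 : ℂ) 1, x = X.facePt c ⟨d x, h⟩ := by
  -- On the face `c` take `F = 1 - r` and `M = (1 - r) z`. Both vanish on the boundary, so they
  -- extend by zero, and `M / F` is the coordinate `z` in the interior.
  obtain ⟨F, hFV, hFA, hFF⟩ := X.exists_canvas_map (T := ℝ) (fun w => 0) (fun _ _ => 0)
    (fun c' i r s => if c' = c then 1 - (r : ℝ) else 0) (fun _ => continuous_const)
    (fun c' i => by split_ifs <;> fun_prop) (fun _ => rfl) (fun _ => rfl)
    (fun c' i s => by simp) (fun c' i r => rfl) (fun c' i j s s' => rfl)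
  obtain ⟨M, hMV, hMA, hMF⟩ := X.exists_canvas_map (T := ℂ) (fun w => 0) (fun _ _ => 0)
    (fun c' i r s => if c' = c then
      ((1 - (r : ℝ) : ℝ) : ℂ) * (sector c'.word.length i r s : ℂ) else 0) (fun _ => continuous_const)
    (fun c' i => by
      split_ifs
      · have h : Continuous fun p : I × I => (i, p.1, p.2) := by fun_prop
        have := (continuous_sector _).comp h
        exact (by fun_prop : Continuous fun p : I × I => ((1 - (p.1 : ℝ) : ℝ) : ℂ)).mul
          (continuous_subtype_val.comp this)
      · exact continuous_const) (fun _ => rfl) (fun _ => rfl)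
    (fun c' i s => by simp) (fun c' i r => by rw [sector_cycSucc])
    (fun c' i j s s' => by rw [sector_zero i j])
  refine ⟨F ⁻¹' Set.Ioi 0, fun x => M x / (F x : ℂ), isOpen_Ioi.preimage F.continuous, ?_, ?_, ?_⟩
  · refine M.continuous.continuousOn.div
      (Complex.continuous_ofReal.comp F.continuous).continuousOn fun x hx => ?_
    exact Complex.ofReal_ne_zero.2 (ne_of_gt hx)
  · intro i r s hr
    change 0 < F _
    rw [hFF, if_pos rfl]
    linarith
  · intro x hx
    change 0 < F x at hx
    have key : ∃ z : Disk, x = X.facePt c z ∧ M x = (F x : ℂ) * z := by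
      induction x using X.canvas_cases with
      | hV w =>
        rw [hFV] at hx
        exact absurd hx (lt_irrefl _)
      | hA a s =>
        rw [hFA] at hx
        exact absurd hx (lt_irrefl _)
      | hF c' i r s =>
        rw [hFF] at hx
        have hc : c' = c := by
          by_contra hc
          simp [hc] at hx
        subst hc
        exact ⟨_, rfl, by rw [hMF, hFF, if_pos rfl, if_pos rfl]⟩
    obtain ⟨z, hz, hM⟩ := key
    have : M x / (F x : ℂ) = z := by
      rw [hM, mul_div_cancel_left₀ _ (Complex.ofReal_ne_zero.2 hx.ne')]
    simp only [this]
    exact ⟨z.2, hz⟩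

end QP

/-! ### The criterion for a canvas to be simply connected. -/

section

variable {Z : Type*} [TopologicalSpace Z] {b : Z} {T : Type*} [TopologicalSpace T]

/-- A path that factors through `f` comes from a path in `T`, and there a lift is compatible by
definition. -/
theorem IsPathLift.trans_eq {P : ∀ x : Z, Path.Homotopic.Quotient x b} {f : C(T, Z)}
    (h : IsPathLift f fun t => ⟨f t, P (f t)⟩) {x y : Z} (γ : Path x y) (δ : C(I, T))
    (hδ : ∀ u, γ u = f (δ u)) : (Path.Homotopic.Quotient.mk γ).trans (P y) = P x := by
  obtain ⟨L, hL, h⟩ := h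
  have hL' : ∀ t, L t = P (f t) := fun t => (eq_of_heq (Sigma.mk.inj (hL t)).2).symm
  obtain rfl : x = f (δ 0) := by rw [← hδ, γ.source]
  obtain rfl : y = f (δ 1) := by rw [← hδ, γ.target]
  have h1 := h _ _ (⟨δ, rfl, rfl⟩ : Path (δ 0) (δ 1))
  rw [hL', hL'] at h1
  rw [← h1]
  congr 2
  ext u
  exact hδ u

theorem trans_eq_of_const {P : ∀ x : Z, Path.Homotopic.Quotient x b} {x y z : Z} (γ : Path x y)
    (h : ∀ t, γ t = z) : (Path.Homotopic.Quotient.mk γ).trans (P y) = P x := by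
  obtain rfl : x = z := by rw [← h 0, γ.source]
  obtain rfl : y = x := by rw [← h 1, γ.target]
  have : γ = Path.refl y := by
    ext t
    exact h t
  rw [this]
  simp

end

namespace QP

variable {k V A : Type*} [Field k] (X : QP k V A)

/-- A canvas is simply connected as soon as the vertices can be joined to a base point by classes
of paths which are compatible with the edges. -/
theorem simplyConnectedSpace_canvas {b : X.Canvas}
    (e : V → Σ x : X.Canvas, Path.Homotopic.Quotient x b) (he : ∀ v, (e v).1 = X.vertexPt v)
    (hedge : ∀ a, ∃ φ, IsPathLift (X.edgeMap a) φ ∧ φ 0 = e (X.src a) ∧ φ 1 = e (X.tgt a)) :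
    SimplyConnectedSpace X.Canvas := by
  obtain ⟨Φ, hΦ, hE, hF⟩ := X.exists_lift_of_edges e he hedge
  have hP : ∃ P : ∀ x : X.Canvas, Path.Homotopic.Quotient x b, ∀ x, Φ x = ⟨x, P x⟩ := by
    have : ∀ x : X.Canvas, ∃ q : Path.Homotopic.Quotient x b, Φ x = ⟨x, q⟩ := by
      intro x
      have := hΦ x
      generalize Φ x = p at this
      obtain ⟨y, q⟩ := p
      obtain rfl : y = x := this
      exact ⟨q, rfl⟩
    choose P hP using this
    exact ⟨P, hP⟩
  obtain ⟨P, hP⟩ := hP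
  obtain rfl : Φ = fun x => ⟨x, P x⟩ := funext hP
  have hE' : ∀ a {x y : X.Canvas} (γ : Path x y) (δ : C(I, I)), (∀ u, γ u = X.edgePt a (δ u)) →
      (Path.Homotopic.Quotient.mk γ).trans (P y) = P x := fun a x y γ δ h => (hE a).trans_eq γ δ h
  have hF' : ∀ c {x y : X.Canvas} (γ : Path x y) (δ : C(I, Disk)),
      (∀ u, γ u = X.facePt c (δ u)) →
      (Path.Homotopic.Quotient.mk γ).trans (P y) = P x := fun c x y γ δ h => (hF c).trans_eq γ δ h
  obtain ⟨H, hHV, hHA, hHF⟩ := X.exists_deformation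
  have h0 : ∀ x, H x 0 = x := fun x => by
    induction x using X.canvas_cases with
    | hV v => rw [hHV]
    | hA a s => rw [hHA, squeeze_at_zero]
    | hF c i r s => rw [hHF, squeeze_at_zero, expand_at_zero]
  have htrack : ∀ x, (Path.Homotopic.Quotient.mk (trackPath H h0 x)).trans (P (H x 1)) = P x := by
    intro x
    induction x using X.canvas_cases with
    | hV v => exact trans_eq_of_const _ fun t => hHV v t
    | hA a s =>
      refine hE' a _ ⟨fun t => squeeze s t, ?_⟩ fun t => hHA a s t
      exact continuous_squeeze.comp (by fun_prop : Continuous fun t : I => (s, t))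
    | hF c i r s =>
      refine hF' c _ ⟨fun t => sector _ i (expand r t) (squeeze s t), ?_⟩ fun t => hHF c i r s t
      have h : Continuous fun t : I => (i, expand r t, squeeze s t) :=
        Continuous.prodMk continuous_const (Continuous.prodMk
          (continuous_expand.comp (by fun_prop : Continuous fun t : I => (r, t)))
          (continuous_squeeze.comp (by fun_prop : Continuous fun t : I => (s, t))))
      exact (continuous_sector _).comp h
  choose UV hUV hUV' hUV'' using X.exists_vertex_nhd H hHV hHA hHF
  choose UA dA hUA hdA hUA' hUA'' using X.exists_edge_nhd H hHA hHF
  choose UF dF hUF hdF hUF' hUF'' using X.exists_face_nhd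
  refine simplyConnectedSpace_of_classes b P (Sum.elim UV (Sum.elim UA UF)) ?_ ?_ ?_
  · rintro (v | a | c)
    exacts [hUV v, hUA a, hUF c]
  · have hedge' : ∀ a s, ∃ i, X.edgePt a s ∈ Sum.elim UV (Sum.elim UA UF) i := by
      intro a s
      by_cases h : s = 0
      · refine ⟨.inl (X.src a), ?_⟩
        rw [h, edgePt_zero]
        exact hUV' _
      by_cases h' : s = 1
      · refine ⟨.inl (X.tgt a), ?_⟩
        rw [h', edgePt_one]
        exact hUV' _
      exact ⟨.inr (.inl a), hUA' a s (unitInterval.pos_iff_ne_zero.2 h)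
        (unitInterval.lt_one_iff_ne_one.2 h')⟩
    intro x
    induction x using X.canvas_cases with
    | hV v => exact ⟨.inl v, hUV' v⟩
    | hA a s => exact hedge' a s
    | hF c i r s =>
      by_cases h : r = 1
      · rw [h, facePt_sector_one]
        exact hedge' _ _
      · exact ⟨.inr (.inr c), hUF' c i r s (unitInterval.lt_one_iff_ne_one.2 h)⟩
  -- In a face the path lifts to the disk directly. Near a vertex or an edge it is first pushed by
  -- `H` into that cell.
  · rintro (v | a | c) x y γ hγ
    · refine trans_eq_of_endPath H h0 P htrack γ ?_
      exact trans_eq_of_const _ fun t => hUV'' v _ (hγ t)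
    · refine trans_eq_of_endPath H h0 P htrack γ ?_
      refine hE' a _ ⟨fun t => dA a (γ t), ?_⟩ fun t => hUA'' a _ (hγ t)
      exact (hdA a).comp_continuous γ.continuous hγ
    · refine hF' c _ ⟨fun t => ⟨dF c (γ t), (hUF'' c _ (hγ t)).1⟩, ?_⟩
        fun t => (hUF'' c _ (hγ t)).2
      exact ((hdF c).comp_continuous γ.continuous hγ).subtype_mk _

/-! ### Maps of canvases induced by morphisms of quivers. -/

theorem norm_exp_mul_mem (x : ℝ) (z : Disk) :
    Complex.exp ((2 * Real.pi * x : ℝ) * Complex.I) * (z : ℂ) ∈ Metric.closedBall (0 : ℂ) 1 := by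
  rw [mem_closedBall_zero_iff, norm_mul, Complex.norm_exp_ofReal_mul_I, one_mul]
  exact mem_closedBall_zero_iff.1 z.2

/-- The rotation of the disk by the angle `2πx`. -/
def diskRotation (x : ℝ) (z : Disk) : Disk := ⟨_, norm_exp_mul_mem x z⟩

theorem continuous_diskRotation (x : ℝ) : Continuous (diskRotation x) := by
  unfold diskRotation
  fun_prop

theorem diskRotation_circlePoint (x y : ℝ) :
    diskRotation x (circlePoint y) = circlePoint (x + y) := by
  ext
  simp only [diskRotation, circlePoint]
  rw [← Complex.exp_add]
  congr 1
  push_cast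
  ring

theorem circlePoint_add_nat (x : ℝ) (m : ℕ) : circlePoint (x + m) = circlePoint x := by
  induction m with
  | zero => simp
  | succ m ih =>
    rw [← ih, ← polar_one, ← polar_one, Nat.cast_succ, ← add_assoc, polar_add_one]

/-- A morphism of quivers that carries the cycles of a potential to cycles of another potential
induces a map of canvases. -/
theorem exists_canvas_hom {k' V' A' : Type*} [Field k'] (Y : QP k' V' A') (fV : V → V')
    (fA : A → A') (hsrc : ∀ a, Y.src (fA a) = fV (X.src a)) (htgt : ∀ a, Y.tgt (fA a) = fV (X.tgt a))
    (hW : ∀ c ∈ X.W.support, c.map fA ∈ Y.W.support) :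
    ∃ Ψ : C(X.Canvas, Y.Canvas), (∀ v, Ψ (X.vertexPt v) = Y.vertexPt (fV v)) ∧
      ∀ a t, Ψ (X.edgePt a t) = Y.edgePt (fA a) t := by
  let fF : X.Face → Y.Face := fun c => ⟨c.1.map fA, hW c.1 c.2⟩
  -- The word chosen for the image face agrees with the image of the chosen word only up to a cyclic
  -- shift `m`; the disk is turned by the fraction `m / l` of a full turn to compensate.
  have hrot : ∀ c : X.Face, ∃ m : ℕ, (fF c).word.rotate m = c.word.map fA := fun c => by
    have h1 : ((fF c).word : Cycle A') = (c.word.map fA : List A') := by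
      rw [Face.coe_word]
      change c.1.map fA = _
      rw [← c.coe_word]
      rfl
    exact Quotient.exact h1
  choose m hm using hrot
  have hlen : ∀ c, (fF c).word.length = c.word.length := fun c => by
    have := congrArg List.length (hm c)
    simpa using this
  let F₀ : X.PreCanvas → Y.Canvas :=
    Sum.elim (fun v => Y.vertexPt (fV v.1)) (Sum.elim (fun a => Y.edgePt (fA a.1) a.2)
      (fun c => Y.facePt (fF c.1) (diskRotation ((m c.1 : ℝ) / c.1.word.length) c.2)))
  have hF₀ : Continuous F₀ := by
    refine Continuous.sumElim ?_ (Continuous.sumElim ?_ ?_)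
    · exact continuous_sigma fun v => @continuous_const _ _ _ _ (Y.vertexPt (fV v))
    · exact continuous_sigma fun a => Y.continuous_edgePt (fA a)
    · refine continuous_sigma fun c => (Y.continuous_facePt (fF c)).comp
        (continuous_diskRotation ((m c : ℝ) / c.word.length))
  have hg : ∀ x y, X.Glue x y → F₀ x = F₀ y := by
    rintro _ _ (a | a | ⟨c, i, t⟩)
    · exact (Y.edgePt_zero _).trans (by rw [hsrc]; rfl)
    · exact (Y.edgePt_one _).trans (by rw [htgt]; rfl)
    · change Y.facePt (fF c) (diskRotation ((m c : ℝ) / c.word.length) (circlePoint _)) =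
        Y.edgePt (fA (c.word.get i)) t
      have hl : (0 : ℝ) < c.word.length := by exact_mod_cast c.length_pos
      let j : Fin (fF c).word.length :=
        ⟨(i + m c) % (fF c).word.length, Nat.mod_lt _ (fF c).length_pos⟩
      have h1 := Nat.mod_add_div (i + m c) (fF c).word.length
      have h2 : circlePoint ((m c : ℝ) / c.word.length + ((i : ℕ) + (t : ℝ)) / c.word.length) =
          circlePoint (((j : ℕ) + (t : ℝ)) / (fF c).word.length) := by
        rw [← circlePoint_add_nat (((j : ℕ) + (t : ℝ)) / (fF c).word.length)
          ((i + m c) / (fF c).word.length)]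
        congr 1
        have h3 : (((i + m c : ℕ)) : ℝ) = (j : ℕ) +
            (fF c).word.length * (((i + m c) / (fF c).word.length : ℕ) : ℝ) := by
          exact_mod_cast h1.symm
        have hL : ((fF c).word.length : ℝ) = c.word.length := by exact_mod_cast hlen c
        rw [hL] at h3 ⊢
        push_cast at h3
        generalize (((i + m c) / (fF c).word.length : ℕ) : ℝ) = q at h3 ⊢
        field_simp
        linarith
      rw [diskRotation_circlePoint, h2, facePt_circlePoint]
      congr 1
      have h4 : (c.word.map fA).get ⟨i, by simp⟩ = fA (c.word.get i) := by simp
      rw [← h4]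
      have h5 : ∀ (l : List A') (h : (fF c).word.rotate (m c) = l) (hi : (i : ℕ) < l.length),
          (fF c).word.get j = l.get ⟨i, hi⟩ := by
        rintro _ rfl hi
        rw [List.get_rotate]
      exact h5 _ (hm c) _
  exact ⟨⟨Quot.lift F₀ hg, continuous_quot_lift hg hF₀⟩, fun _ => rfl, fun _ _ => rfl⟩

end QP

/-! ### The punctured disk, and separation of the cells of a canvas. -/

/-- The open ball is homeomorphic to the plane, where the complement of at most one point is
connected; the punctured closed ball lies between the punctured open ball and its closure. -/
theorem isPreconnected_closedBall_diff_singleton (x : ℂ) :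
    IsPreconnected (Metric.closedBall (0 : ℂ) 1 \ {x}) := by
  have hinj : Function.Injective fun y : ℂ => ((Homeomorph.unitBall y : Metric.ball (0 : ℂ) 1) : ℂ) :=
    Subtype.val_injective.comp Homeomorph.unitBall.injective
  have h1 : ({y : ℂ | ((Homeomorph.unitBall y : Metric.ball (0 : ℂ) 1) : ℂ) = x} : Set ℂ).Countable :=
    Set.Subsingleton.countable fun y hy z hz => hinj (Eq.trans hy (Eq.symm hz))
  have h2 := (h1.isConnected_compl_of_one_lt_rank (by simp [Complex.rank_real_complex])).isPreconnected
  have h3 := h2.image (fun y : ℂ => ((Homeomorph.unitBall y : Metric.ball (0 : ℂ) 1) : ℂ))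
    (by fun_prop)
  refine h3.subset_closure ?_ ?_
  · rintro _ ⟨y, hy, rfl⟩
    exact ⟨Metric.ball_subset_closedBall (Subtype.property _), hy⟩
  · have h4 : {x}ᶜ ∩ Metric.ball (0 : ℂ) 1 ⊆
        (fun y : ℂ => ((Homeomorph.unitBall y : Metric.ball (0 : ℂ) 1) : ℂ)) ''
          {y : ℂ | ((Homeomorph.unitBall y : Metric.ball (0 : ℂ) 1) : ℂ) = x}ᶜ := by
      rintro z ⟨hz, hz'⟩
      obtain ⟨y, hy⟩ := Homeomorph.unitBall.surjective (⟨z, hz'⟩ : Metric.ball (0 : ℂ) 1)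
      have hy' : ((Homeomorph.unitBall y : Metric.ball (0 : ℂ) 1) : ℂ) = z := by rw [hy]
      refine ⟨y, ?_, hy'⟩
      change _ ≠ _
      rw [hy']
      exact hz
    rintro z ⟨hz, hz'⟩
    refine closure_mono h4 ((isOpen_compl_singleton (x := x)).inter_closure ⟨hz', ?_⟩)
    rwa [closure_ball _ one_ne_zero]

namespace QP

theorem isPreconnected_disk_compl_singleton (x : Disk) : IsPreconnected ({x}ᶜ : Set Disk) := by
  rw [← Topology.IsInducing.subtypeVal.isPreconnected_image]
  convert! isPreconnected_closedBall_diff_singleton x using 1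
  ext z
  constructor
  · rintro ⟨y, hy, rfl⟩
    exact ⟨y.2, fun h => hy (Subtype.ext h)⟩
  · rintro ⟨hz, hz'⟩
    exact ⟨⟨z, hz⟩, fun h => hz' (congrArg Subtype.val h), rfl⟩

variable {k V A : Type*} [Field k] (X : QP k V A)

theorem isPreconnected_compl_singleton (h : X.Canvas ≃ₜ Disk) (x : X.Canvas) :
    IsPreconnected ({x}ᶜ : Set X.Canvas) := by
  rw [← h.isPreconnected_image, Set.image_compl_eq h.bijective, Set.image_singleton]
  exact isPreconnected_disk_compl_singleton _

/-- A property of the cells which is compatible with the attaching maps off a closed set with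
connected complement is constant off that set. -/
theorem vertex_of_isPreconnected {B : Set X.Canvas} (hB : IsClosed B) (hB' : IsPreconnected Bᶜ)
    (χV : V → Prop) (χA : A → Prop) (χF : X.Face → Prop)
    (hsrc : ∀ a, X.vertexPt (X.src a) ∉ B → (χA a ↔ χV (X.src a)))
    (htgt : ∀ a, X.vertexPt (X.tgt a) ∉ B → (χA a ↔ χV (X.tgt a)))
    (hF : ∀ (c : X.Face) (i : Fin c.word.length) (t : I), X.edgePt (c.word.get i) t ∉ B →
      (χF c ↔ χA (c.word.get i)))
    {v w : V} (hv : X.vertexPt v ∉ B) (hw : X.vertexPt w ∉ B) (h : χV v) : χV w := by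
  let χ : X.PreCanvas → Prop :=
    Sum.elim (fun v => χV v.1) (Sum.elim (fun a => χA a.1) (fun c => χF c.1))
  let π : X.PreCanvas → X.Canvas := Quot.mk _
  have hglue : ∀ p q, X.Glue p q → π p ∉ B → (χ p ↔ χ q) := by
    intro p q h
    have hpq : π p = π q := Quot.sound h
    rw [hpq]
    rcases h with (a | a | ⟨c, i, t⟩)
    · exact hsrc a
    · exact htgt a
    · exact hF c i t
  have hgen : ∀ p q, π p = π q → π p ∉ B → (χ p ↔ χ q) := by
    intro p q h
    have h' := Quot.eqvGen_exact h
    clear h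
    induction h' with
    | rel p q h => exact hglue p q h
    | refl p => exact fun _ => Iff.rfl
    | symm p q h ih =>
      have : π p = π q := Quot.eqvGen_sound h
      intro hq
      exact (ih (this ▸ hq)).symm
    | trans p q r h h' ih ih' =>
      have : π p = π q := Quot.eqvGen_sound h
      intro hp
      exact (ih hp).trans (ih' (this ▸ hp))
  -- Applied with `id` and `Not`, this gives the sets where the property holds and where it fails.
  -- Their preimages are unions of whole cells minus the preimage of `B`.
  have hopen : ∀ χ' : Prop → Prop, IsOpen {x | x ∉ B ∧ ∃ p, π p = x ∧ χ' (χ p)} := by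
    intro χ'
    have h1 : IsOpen {p | χ' (χ p)} := by
      rw [isOpen_sum_iff, isOpen_sum_iff, isOpen_sigma_iff, isOpen_sigma_iff, isOpen_sigma_iff]
      exact ⟨fun v => @isOpen_const _ _ (χ' (χV v)), fun a => @isOpen_const _ _ (χ' (χA a)),
        fun c => @isOpen_const _ _ (χ' (χF c))⟩
    have h2 : IsOpen (π ⁻¹' Bᶜ ∩ {p | χ' (χ p)}) :=
      (hB.isOpen_compl.preimage continuous_quot_mk).inter h1
    refine isQuotientMap_quot_mk.isOpen_preimage.1 ?_
    convert! h2 using 1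
    ext p
    constructor
    · rintro ⟨hp, q, hq, hq'⟩
      refine ⟨hp, ?_⟩
      change χ' (χ p)
      rwa [← propext (hgen q p hq (by rw [hq]; exact hp))]
    · rintro ⟨hp, hp'⟩
      exact ⟨hp, p, rfl, hp'⟩
  by_contra hcon
  obtain ⟨x, hx, ⟨-, p, hp, hp'⟩, -, q, hq, hq'⟩ := hB' _ _ (hopen id) (hopen Not)
    (fun x hx => by
      induction x using Quot.ind with | mk p =>
      by_cases hp : χ p
      · exact Or.inl ⟨hx, p, rfl, hp⟩
      · exact Or.inr ⟨hx, p, rfl, hp⟩)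
    ⟨X.vertexPt v, hv, hv, _, rfl, h⟩ ⟨X.vertexPt w, hw, hw, _, rfl, hcon⟩
  exact hq' ((hgen p q (hp.trans hq.symm) (by rw [hp]; exact hx)).1 hp')

/-- The coordinates of the points of the 1-skeleton. -/
theorem exists_skeleton_coord : ∃ F : X.Canvas → V ⊕ (A × I) ⊕ Unit,
    (∀ v, F (X.vertexPt v) = .inl v) ∧
    ∀ a t, t ≠ 0 → t ≠ 1 → F (X.edgePt a t) = .inr (.inl (a, t)) := by
  let fA : A → I → V ⊕ (A × I) ⊕ Unit := fun a t =>
    if t = 0 then .inl (X.src a) else if t = 1 then .inl (X.tgt a) else .inr (.inl (a, t))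
  -- With the indiscrete topology `⊤` on the target, continuity is automatic, so only
  -- well-definedness of a function is at stake.
  obtain ⟨F, hV, hA, -⟩ := @exists_canvas_map k V A _ X (V ⊕ (A × I) ⊕ Unit) ⊤ Sum.inl fA
    (fun c i r s => if r = 1 then fA (c.word.get i) s else .inr (.inr ()))
    (fun _ => continuous_top) (fun _ _ => continuous_top)
    (fun a => by simp [fA]) (fun a => by simp [fA])
    (fun c i s => by simp)
    (fun c i r => by
      by_cases hr : r = 1
      · simpa [hr, fA] using c.tgt_get i
      · simp [hr])
    (fun c i j s s' => by simp)
  exact ⟨F, hV, fun a t h h' => by rw [hA]; simp [fA, h, h']⟩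

theorem vertexPt_injective : Function.Injective X.vertexPt := by
  obtain ⟨F, hV, -⟩ := X.exists_skeleton_coord
  intro v w h
  have := congrArg F h
  rw [hV, hV] at this
  exact Sum.inl_injective this

theorem edgePt_injective {t : I} (h0 : t ≠ 0) (h1 : t ≠ 1) :
    Function.Injective fun a => X.edgePt a t := by
  obtain ⟨F, -, hA⟩ := X.exists_skeleton_coord
  intro a b h
  have := congrArg F h
  simp only [hA _ _ h0 h1] at this
  simpa using this

theorem edgePt_ne_vertexPt {t : I} (h0 : t ≠ 0) (h1 : t ≠ 1) (a : A) (v : V) :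
    X.edgePt a t ≠ X.vertexPt v := by
  obtain ⟨F, hV, hA⟩ := X.exists_skeleton_coord
  intro h
  have := congrArg F h
  rw [hV, hA _ _ h0 h1] at this
  simp at this

end QP

/-! ### Fixed points of an action by rotations. -/

section Rotation

variable {k V A G : Type*} [Field k] [Group G] [MulAction G V] [MulAction G A]

/-- Every element of the group acts by a rotation about the same centre. -/
theorem exists_circle_of_isInducedByRotation {X : QP k V A} {h : G}
    (hh : ∀ x : G, x ∈ Subgroup.zpowers h) (hX : IsInducedByRotation X h) :
    ∃ (φ : X.Canvas → ℂ) (p : ℂ), Function.Injective φ ∧ ∀ x : G, ∃ u : Circle,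
      (∀ v, φ (X.vertexPt (x • v)) - p = u * (φ (X.vertexPt v) - p)) ∧
      ∀ a t, φ (X.edgePt (x • a) t) - p = u * (φ (X.edgePt a t) - p) := by
  obtain ⟨φ, p, w, hφ, hV, hA, -⟩ := hX
  refine ⟨φ, p, hφ.injective, ?_⟩
  -- The elements that act by rotations about `p` form a subgroup containing the generator.
  let K : Subgroup G :=
    { carrier := {x | ∃ u : Circle, (∀ v, φ (X.vertexPt (x • v)) - p = u * (φ (X.vertexPt v) - p)) ∧
        ∀ a t, φ (X.edgePt (x • a) t) - p = u * (φ (X.edgePt a t) - p)}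
      one_mem' := ⟨1, by simp, by simp⟩
      mul_mem' := by
        rintro x y ⟨u, hu, hu'⟩ ⟨u', hv, hv'⟩
        refine ⟨u * u', fun v => ?_, fun a t => ?_⟩
        · rw [mul_smul, hu, hv, Circle.coe_mul, mul_assoc]
        · rw [mul_smul, hu', hv', Circle.coe_mul, mul_assoc]
      inv_mem' := by
        rintro x ⟨u, hu, hu'⟩
        refine ⟨u⁻¹, fun v => ?_, fun a t => ?_⟩
        · have := hu (x⁻¹ • v)
          rw [smul_inv_smul] at this
          rw [this, ← mul_assoc, ← Circle.coe_mul, inv_mul_cancel, Circle.coe_one, one_mul]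
        · have := hu' (x⁻¹ • a) t
          rw [smul_inv_smul] at this
          rw [this, ← mul_assoc, ← Circle.coe_mul, inv_mul_cancel, Circle.coe_one, one_mul] }
  have hK : Subgroup.zpowers h ≤ K := by
    rw [Subgroup.zpowers_le]
    refine ⟨w, fun v => ?_, fun a t => ?_⟩
    · rw [← hV, planeRotation]
      ring
    · rw [← hA, planeRotation]
      ring
  exact fun x => hK (hh x)

/-- A nontrivial group of rotations with a fixed vertex has only one fixed vertex, acts freely on
the other vertices, and there is no arrow between fixed vertices. -/
theorem ActsByRotations.exists_unique_fixed {X : QP k V A} (hrot : ActsByRotations X G)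
    (hfix : ∃ v : V, IsFixedVertex G v)
    (harr : ∀ a : A, IsFixedVertex G (X.src a) → IsFixedVertex G (X.tgt a) → ∀ h : G, h • a = a)
    (hG : Nontrivial G) :
    ∃ v₀ : V, (∀ v, IsFixedVertex G v ↔ v = v₀) ∧ (∀ v, v ≠ v₀ → ∀ x : G, x • v = v → x = 1) ∧
      ∀ a, X.src a = v₀ → X.tgt a ≠ v₀ := by
  obtain ⟨h, hh, hX⟩ := hrot.rotation
  obtain ⟨φ, p, hφ, hu⟩ := exists_circle_of_isInducedByRotation hh hX
  obtain ⟨v₀, hv₀⟩ := hfix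
  have h2 : (0 : ℝ) ≤ 1 / 2 ∧ (1 / 2 : ℝ) ≤ 1 := by norm_num
  -- Any interior parameter would do: interior points distinguish arrows and are never vertices.
  let m : I := ⟨1 / 2, h2⟩
  have hm0 : m ≠ 0 := fun h => by
    have := congrArg Subtype.val h
    norm_num [m] at this
  have hm1 : m ≠ 1 := fun h => by
    have := congrArg Subtype.val h
    norm_num [m] at this
  have hne : ∀ (x : G), x ≠ 1 → ∀ u : Circle,
      (∀ v, φ (X.vertexPt (x • v)) - p = u * (φ (X.vertexPt v) - p)) →
      (∀ a t, φ (X.edgePt (x • a) t) - p = u * (φ (X.edgePt a t) - p)) → (u : ℂ) ≠ 1 := by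
    intro x hx u hV hA hu1
    refine hx (hrot.faithful x (fun v => ?_) fun a => ?_)
    · have := hV v
      rw [hu1, one_mul, sub_left_inj] at this
      exact X.vertexPt_injective (hφ this)
    · have := hA a m
      rw [hu1, one_mul, sub_left_inj] at this
      exact X.edgePt_injective hm0 hm1 (hφ this)
  have hcenter : ∀ (u z : ℂ), u ≠ 1 → z - p = u * (z - p) → z = p := by
    intro u z hu hz
    have h1 : (u - 1) * (z - p) = 0 := by linear_combination -hz
    rcases mul_eq_zero.1 h1 with h | h
    · exact absurd (sub_eq_zero.1 h) hu
    · exact sub_eq_zero.1 h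
  have hfixp : ∀ (x : G), x ≠ 1 → ∀ v, x • v = v → φ (X.vertexPt v) = p := by
    intro x hx v hv
    obtain ⟨u, hV, hA⟩ := hu x
    have := hV v
    rw [hv] at this
    exact hcenter u _ (hne x hx u hV hA) this
  obtain ⟨x₀, hx₀⟩ := exists_ne (1 : G)
  have hp := hfixp x₀ hx₀ v₀ (hv₀ x₀)
  have huniq : ∀ (x : G), x ≠ 1 → ∀ v, x • v = v → v = v₀ := fun x hx v hv =>
    X.vertexPt_injective (hφ ((hfixp x hx v hv).trans hp.symm))
  refine ⟨v₀, fun v => ⟨fun hv => huniq x₀ hx₀ v (hv x₀), fun hv => hv ▸ hv₀⟩,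
    fun v hv x hx => ?_, fun a hs ht => ?_⟩
  · by_contra hx1
    exact hv (huniq x hx1 v hx)
  -- An arrow from `v₀` to itself is fixed by assumption, so its midpoint would be the centre, which
  -- is already the position of `v₀`.
  · have h1 := harr a (hs ▸ hv₀) (ht ▸ hv₀) x₀
    obtain ⟨u, hV, hA⟩ := hu x₀
    have := hA a m
    rw [h1] at this
    have h3 := hcenter u _ (hne x₀ hx₀ u hV hA) this
    exact X.edgePt_ne_vertexPt hm0 hm1 a v₀ (hφ (h3.trans hp.symm))

theorem ActsByRotations.finite [Finite V] [Finite A] {X : QP k V A} (hrot : ActsByRotations X G) :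
    Finite G := by
  refine Finite.of_injective (fun g : G => ((fun v => g • v : V → V), (fun a => g • a : A → A))) ?_
  intro g g' h
  have h1 : (fun v : V => g • v) = fun v => g' • v := congrArg Prod.fst h
  have h2 : (fun a : A => g • a) = fun a => g' • a := congrArg Prod.snd h
  have h3 : g'⁻¹ * g = 1 := hrot.faithful _
    (fun v => by
      rw [mul_smul, show g • v = g' • v from congrFun h1 v, inv_smul_smul])
    (fun a => by
      rw [mul_smul, show g • a = g' • a from congrFun h2 a, inv_smul_smul])
  exact (inv_mul_eq_one.1 h3).symm

end Rotation

/-! ### Combinatorics of tilde arrows and tilde cycles. -/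

section FixedCount

variable {V A : Type*} {Q : RepQuiver V A} {G : Type*} [Group G] [MulAction G V]

/-- Cut the cycle at its fixed vertex, if it has one; every later joint of the word is then a free
vertex. -/
theorem RepQuiver.exists_word_of_fixedCount_le_one {c : Cycle A} (hc : c ≠ Cycle.nil)
    (h : Q.fixedCount G c ≤ 1) :
    ∃ a l, c = ((a :: l : List A) : Cycle A) ∧ ∀ b ∈ l, ¬ IsFixedVertex G (Q.src b) := by
  induction c using Quotient.inductionOn' with
  | h l =>
    by_cases hl : ∃ a ∈ l, IsFixedVertex G (Q.src a)
    · obtain ⟨a, ha, haf⟩ := hl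
      obtain ⟨s, t, rfl⟩ := List.append_of_mem ha
      have hrot : (Quotient.mk'' (s ++ a :: t) : Cycle A) = ((a :: (t ++ s) : List A) : Cycle A) :=
        Quotient.sound (List.isRotated_append (l := s) (l' := a :: t))
      refine ⟨a, t ++ s, hrot, fun b hb hbf => ?_⟩
      rw [hrot] at h
      have h1 : Q.fixedCount G ((a :: (t ++ s) : List A) : Cycle A) =
          ((a :: (t ++ s)).map Q.src).countP fun v => decide (IsFixedVertex G v) := by
        rfl
      rw [h1, List.map_cons, List.countP_cons_of_pos (by simpa using haf)] at h
      have h2 : 0 < ((t ++ s).map Q.src).countP fun v => decide (IsFixedVertex G v) := by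
        rw [List.countP_pos_iff]
        exact ⟨Q.src b, List.mem_map_of_mem hb, by simpa using hbf⟩
      omega
    · cases l with
      | nil => exact absurd rfl hc
      | cons a l => exact ⟨a, l, rfl, fun b hb hbf => hl ⟨b, by simp [hb], hbf⟩⟩

theorem RepQuiver.not_isFixedVertex_src_of_typeI {c : Cycle A} (hc : Q.TypeI G c) {a : A}
    (ha : a ∈ c) : ¬ IsFixedVertex G (Q.src a) := by
  induction c using Quotient.inductionOn' with
  | h l =>
    have h1 : (l.map Q.src).countP (fun v => decide (IsFixedVertex G v)) = 0 := hc
    rw [List.countP_eq_zero] at h1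
    simpa using h1 (Q.src a) (List.mem_map_of_mem ha)

end FixedCount

theorem RepQuiver.IsCycle.isChain {V A : Type*} {Q : RepQuiver V A} {a : A} {l : List A}
    (h : Q.IsCycle ((a :: l : List A) : Cycle A)) :
    (a :: l).IsChain fun a b => Q.tgt a = Q.src b := by
  unfold RepQuiver.IsCycle at h
  rw [Cycle.chain_coe_cons, ← List.cons_append] at h
  exact h.left_of_append

section SkewCombinatorics

variable {k V A : Type*} [Field k] {G : Type*} [Group G] [MulAction G V] [MulAction G A]
  (Q : RepQuiver V A) [Q.IsActedOnBy G] (R : VertexReps G V)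

theorem tildeVertex_eq_of_fixed {v w : V} {μ ν : ZMod (Nat.card G)} (hv : IsFixedVertex G v)
    (h : tildeVertex R μ v = tildeVertex R ν w) : v = w ∧ μ = ν := by
  by_cases hw : IsFixedVertex G w
  · simpa [tildeVertex, hv, hw] using h
  · simp [tildeVertex, hv, hw] at h

theorem tildeVertex_eq_of_not_fixed {v w : V} {μ ν : ZMod (Nat.card G)}
    (hv : ¬ IsFixedVertex G v) (h : tildeVertex R μ v = tildeVertex R ν w) :
    ∃ x : G, w = x • v := by
  by_cases hw : IsFixedVertex G w
  · simp [tildeVertex, hv, hw] at h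
  · have h1 : R.rep v = R.rep w := by simpa [tildeVertex, hv, hw] using h
    refine ⟨(R.toRep w)⁻¹ * R.toRep v, ?_⟩
    rw [mul_smul, eq_inv_smul_iff]
    exact h1.symm

theorem exists_tildeVertex_eq (z : SkewVertex R) : ∃ μ v, tildeVertex R μ v = z := by
  cases z with
  | free v hE hv => exact ⟨0, v, by simp [tildeVertex, hv, R.rep_of_mem hE]⟩
  | fixed v hE hv μ => exact ⟨μ, v, by simp [tildeVertex, hv]⟩

/-- The arrow of the original quiver from which an arrow of the skew quiver arises. -/
def SkewArrow.base {Q : RepQuiver V A} {R : VertexReps G V} : SkewArrow Q R → A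
  | .type1 a _ _ _ => a
  | .type2 a _ _ _ _ => a
  | .type3 a _ _ _ _ => a
  | .type4 a _ _ _ => a

theorem exists_base_tildeArrow (μ : ZMod (Nat.card G)) (a : A) :
    ∃ x : G, (tildeArrow Q R μ a).base = x • a := by
  unfold tildeArrow
  split_ifs
  · exact ⟨1, by simp [SkewArrow.base]⟩
  all_goals exact ⟨_, rfl⟩

theorem exists_smul_of_tildeArrow_eq {a b : A} {μ ν : ZMod (Nat.card G)}
    (h : tildeArrow Q R μ a = tildeArrow Q R ν b) : ∃ x : G, b = x • a := by
  obtain ⟨x, hx⟩ := exists_base_tildeArrow Q R μ a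
  obtain ⟨y, hy⟩ := exists_base_tildeArrow Q R ν b
  rw [h, hy] at hx
  exact ⟨y⁻¹ * x, by rw [mul_smul, ← hx, inv_smul_smul]⟩

theorem tildeArrow_eq_of_not_fixed {a : A} (hs : ¬ IsFixedVertex G (Q.src a))
    (ht : ¬ IsFixedVertex G (Q.tgt a)) (μ ν : ZMod (Nat.card G)) :
    tildeArrow Q R μ a = tildeArrow Q R ν a := by
  simp [tildeArrow, hs, ht]

variable {Q R}

theorem VertexReps.eq_toRep_of_smul_mem
    (hfree : ∀ v : V, ¬ IsFixedVertex G v → ∀ x : G, x • v = v → x = 1)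
    {v : V} (hv : ¬ IsFixedVertex G v) {x : G} (hx : x • v ∈ R.E) : x = R.toRep v := by
  have h1 : x • v = R.toRep v • v := R.eq_rep hx
  have h2 := hfree v hv ((R.toRep v)⁻¹ * x) (by rw [mul_smul, h1, inv_smul_smul])
  exact (inv_mul_eq_one.1 h2).symm

/-- By freeness only one group element carries a given non-fixed vertex to its representative, so an
arrow and its translate are moved to the same arrow. -/
theorem tildeArrow_smul (hfree : ∀ v : V, ¬ IsFixedVertex G v → ∀ x : G, x • v = v → x = 1)
    (harr : ∀ a : A, IsFixedVertex G (Q.src a) → IsFixedVertex G (Q.tgt a) → ∀ h : G, h • a = a)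
    (μ : ZMod (Nat.card G)) (x : G) (a : A) :
    tildeArrow Q R μ (x • a) = tildeArrow Q R μ a := by
  have key : ∀ v : V, ¬ IsFixedVertex G v → (R.toRep (x • v) • x • a) = R.toRep v • a := by
    intro v hv
    rw [smul_smul]
    congr 1
    refine R.eq_toRep_of_smul_mem hfree hv ?_
    rw [mul_smul]
    exact R.toRep_smul_mem _
  by_cases hs : IsFixedVertex G (Q.src a) <;> by_cases ht : IsFixedVertex G (Q.tgt a)
  · rw [harr a hs ht]
  · simp only [tildeArrow, RepQuiver.IsActedOnBy.src_smul, RepQuiver.IsActedOnBy.tgt_smul,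
      isFixedVertex_smul, hs, ht, dite_true, dite_false, key _ ht]
  · simp only [tildeArrow, RepQuiver.IsActedOnBy.src_smul, RepQuiver.IsActedOnBy.tgt_smul,
      isFixedVertex_smul, hs, ht, dite_true, dite_false, key _ hs]
  · simp only [tildeArrow, RepQuiver.IsActedOnBy.src_smul, RepQuiver.IsActedOnBy.tgt_smul,
      isFixedVertex_smul, hs, ht, dite_false, key _ ht]

theorem exists_tildeArrow_eq
    (hfree : ∀ v : V, ¬ IsFixedVertex G v → ∀ x : G, x • v = v → x = 1)
    (b : SkewArrow Q R) : ∃ μ a, tildeArrow Q R μ a = b := by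
  have key : ∀ v : V, ¬ IsFixedVertex G v → v ∈ R.E → R.toRep v = 1 := by
    intro v hv hE
    exact (R.eq_toRep_of_smul_mem hfree hv (by rwa [one_smul])).symm
  cases b with
  | type1 a hs ht hE => exact ⟨0, a, by simp [tildeArrow, hs, ht, key _ ht hE]⟩
  | type2 a hs ht hE μ => exact ⟨μ, a, by simp [tildeArrow, hs, ht, key _ hs hE]⟩
  | type3 a hs ht hE μ => exact ⟨μ, a, by simp [tildeArrow, hs, ht, key _ ht hE]⟩
  | type4 a hs ht μ => exact ⟨μ, a, by simp [tildeArrow, hs, ht]⟩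

theorem tildeCycle_translateCycle
    (hfree : ∀ v : V, ¬ IsFixedVertex G v → ∀ x : G, x • v = v → x = 1)
    (harr : ∀ a : A, IsFixedVertex G (Q.src a) → IsFixedVertex G (Q.tgt a) → ∀ h : G, h • a = a)
    (μ : ZMod (Nat.card G)) (x : G) (c : Cycle A) :
    tildeCycle Q R μ (translateCycle x c) = tildeCycle Q R μ c := by
  induction c using Quotient.inductionOn' with
  | h l =>
    change ((List.map (tildeArrow Q R μ) (l.map fun a => x • a) : List (SkewArrow Q R)) :
      Cycle (SkewArrow Q R)) =
      ((List.map (tildeArrow Q R μ) l : List (SkewArrow Q R)) : Cycle (SkewArrow Q R))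
    rw [List.map_map]
    congr 2
    funext a
    exact tildeArrow_smul hfree harr μ x a

/-- A path which passes only through vertices that are not fixed is determined, up to its first
arrow, by its image in the skew quiver. -/
theorem eq_map_smul_of_map_tildeArrow_eq
    (hfree : ∀ v : V, ¬ IsFixedVertex G v → ∀ x : G, x • v = v → x = 1)
    {μ ν : ZMod (Nat.card G)} (x : G) (l m : List A) (a : A)
    (hl : (a :: l).IsChain fun a b => Q.tgt a = Q.src b)
    (hm : ((x • a) :: m).IsChain fun a b => Q.tgt a = Q.src b)
    (h : l.map (tildeArrow Q R μ) = m.map (tildeArrow Q R ν))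
    (hfix : ∀ b ∈ l, ¬ IsFixedVertex G (Q.src b)) : m = l.map fun b => x • b := by
  induction l generalizing m a with
  | nil =>
    symm at h
    simpa using h
  | cons b l ih =>
    cases m with
    | nil => simp at h
    | cons b' m =>
      simp only [List.map_cons, List.cons.injEq] at h
      rw [List.isChain_cons_cons] at hl hm
      obtain ⟨y, rfl⟩ := exists_smul_of_tildeArrow_eq Q R h.1
      have h1 : x • Q.src b = y • Q.src b := by
        rw [← hl.1, ← RepQuiver.IsActedOnBy.tgt_smul, hm.1, RepQuiver.IsActedOnBy.src_smul, hl.1]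
      -- Consecutive arrows are translated by `x` and `y`; both elements act equally on the free
      -- vertex between the arrows, so they coincide.
      have h2 := hfree (Q.src b) (hfix b (by simp)) (y⁻¹ * x) (by
        rw [mul_smul, h1, inv_smul_smul])
      obtain rfl : y = x := inv_mul_eq_one.1 h2
      rw [List.map_cons, ih m b hl.2 hm.2 h.2 fun b' hb' => hfix b' (by simp [hb'])]

/-- Equal tilde arrows are translates of each other. With the word cut at the fixed vertex, the
translating element of the first arrow propagates through all later joints. -/
theorem mem_cycleOrbit_of_tildeCycle_eq
    (hfree : ∀ v : V, ¬ IsFixedVertex G v → ∀ x : G, x • v = v → x = 1)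
    {c d : Cycle A} (hc : Q.IsCycle c) (hd : Q.IsCycle d) (hnil : c ≠ Cycle.nil)
    (hcount : Q.fixedCount G c ≤ 1) {μ ν : ZMod (Nat.card G)}
    (h : tildeCycle Q R μ c = tildeCycle Q R ν d) : d ∈ cycleOrbit G c := by
  obtain ⟨a, l, rfl, hl⟩ := Q.exists_word_of_fixedCount_le_one hnil hcount
  induction d using Quotient.inductionOn' with
  | h m =>
    have h1 : (m.map (tildeArrow Q R ν)) ~r ((a :: l).map (tildeArrow Q R μ)) :=
      (Quotient.exact h).symm
    obtain ⟨n, hn⟩ := h1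
    rw [← List.map_rotate] at hn
    have hm : (Quotient.mk'' m : Cycle A) = ((m.rotate n : List A) : Cycle A) :=
      Quotient.sound ⟨n, rfl⟩
    rw [hm] at hd ⊢
    generalize m.rotate n = m' at hn hd
    cases m' with
    | nil => simp at hn
    | cons b m' =>
      simp only [List.map_cons, List.cons.injEq] at hn
      obtain ⟨x, rfl⟩ := exists_smul_of_tildeArrow_eq Q R hn.1.symm
      have := eq_map_smul_of_map_tildeArrow_eq hfree x l m' a hc.isChain hd.isChain hn.2.symm hl
      refine ⟨x, ?_⟩
      rw [this]
      rfl

/-- The superscript can be read off at a fixed vertex of the cycle. -/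
theorem eq_of_tildeCycle_eq {c : Cycle A} (hc : ¬ Q.TypeI G c) {μ ν : ZMod (Nat.card G)}
    (h : tildeCycle Q R μ c = tildeCycle Q R ν c) : μ = ν := by
  induction c using Quotient.inductionOn' with
  | h l =>
    have h1 : 0 < (l.map Q.src).countP fun v => decide (IsFixedVertex G v) :=
      Nat.pos_of_ne_zero hc
    rw [List.countP_pos_iff] at h1
    obtain ⟨v, hv, hvf⟩ := h1
    obtain ⟨a, ha, rfl⟩ := List.mem_map.1 hv
    have h2 : (l.map (tildeArrow Q R μ)) ~r (l.map (tildeArrow Q R ν)) := Quotient.exact h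
    have h3 := (h2.mem_iff (a := tildeArrow Q R μ a)).1 (List.mem_map_of_mem ha)
    obtain ⟨b, hb, hab⟩ := List.mem_map.1 h3
    have h4 := congrArg (skewQuiver Q R).src hab
    rw [src_tildeArrow, src_tildeArrow] at h4
    exact (tildeVertex_eq_of_fixed R (by simpa using hvf) h4.symm).2

theorem tildeCycle_eq_of_typeI {c : Cycle A} (hcyc : Q.IsCycle c) (hc : Q.TypeI G c)
    (μ ν : ZMod (Nat.card G)) : tildeCycle Q R μ c = tildeCycle Q R ν c := by
  have h1 := fun (a : A) (ha : a ∈ c) => Q.not_isFixedVertex_src_of_typeI hc ha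
  induction c using Quotient.inductionOn' with
  | h l =>
    change ((l.map (tildeArrow Q R μ) : List (SkewArrow Q R)) : Cycle (SkewArrow Q R)) =
      ((l.map (tildeArrow Q R ν) : List (SkewArrow Q R)) : Cycle (SkewArrow Q R))
    congr 1
    refine List.map_congr_left fun a ha => ?_
    refine tildeArrow_eq_of_not_fixed Q R (h1 a ha) ?_ μ ν
    obtain ⟨i, rfl⟩ := List.get_of_mem ha
    have h2 : Q.tgt (l.get i) = Q.src (l.get (QP.cycSucc i)) := RepQuiver.IsCycle.tgt_get hcyc i
    rw [h2]
    exact h1 _ (List.get_mem l _)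

end SkewCombinatorics

section FixedCount

variable {V A : Type*} {Q : RepQuiver V A} {G : Type*} [Group G] [MulAction G V]

theorem RepQuiver.IsCycle.map_tgt {l : List A} (h : Q.IsCycle (l : Cycle A)) :
    l.map Q.tgt = (l.map Q.src).rotate 1 := by
  refine List.ext_getElem (by simp) fun i hi hi' => ?_
  have h1 := h.tgt_get ⟨i, by simpa using hi⟩
  rw [List.getElem_rotate]
  simpa [QP.cycSucc] using h1

/-- Each arrow leaving a fixed vertex ends at a non-fixed one, and around a cycle the targets are
the sources shifted by one place. -/
theorem RepQuiver.two_mul_fixedCount_le {c : Cycle A} (hc : Q.IsCycle c)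
    (h : ∀ a, IsFixedVertex G (Q.src a) → ¬ IsFixedVertex G (Q.tgt a)) :
    2 * Q.fixedCount G c ≤ c.length := by
  induction c using Quotient.inductionOn' with
  | h l =>
    let p : V → Bool := fun v => decide (IsFixedVertex G v)
    change 2 * (l.map Q.src).countP p ≤ l.length
    have h1 : (l.map Q.src).countP p ≤ (l.map Q.tgt).countP fun v => !p v := by
      rw [List.countP_map, List.countP_map]
      refine List.countP_mono_left fun a _ ha => ?_
      simpa [p] using h a (by simpa [p] using ha)
    have h2 : (l.map Q.tgt).countP (fun v => !p v) = (l.map Q.src).countP fun v => !p v := by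
      rw [RepQuiver.IsCycle.map_tgt hc]
      exact (List.rotate_perm _ _).countP_eq _
    have h3 := List.length_eq_countP_add_countP p (l := l.map Q.src)
    rw [List.length_map] at h3
    have h4 : (l.map Q.src).countP (fun v => !p v) = (l.map Q.src).countP fun v => ¬ p v := by
      congr 1
      funext v
      simp
    omega

end FixedCount

/-! ### Absence of cancellation in the skew potential. -/

section Support

theorem translateCycle_one {G A : Type*} [Group G] [MulAction G A] (c : Cycle A) : translateCycle (1 : G) c = c := by
  induction c using Quotient.inductionOn' with
  | h l =>
    change ((l.map fun a => (1 : G) • a : List A) : Cycle A) = (l : Cycle A)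
    simp

theorem translateCycle_mul {G A : Type*} [Group G] [MulAction G A] (x y : G) (c : Cycle A) :
    translateCycle (x * y) c = translateCycle x (translateCycle y c) := by
  induction c using Quotient.inductionOn' with
  | h l =>
    change ((l.map fun a => (x * y) • a : List A) : Cycle A) =
      (((l.map fun a => y • a).map fun a => x • a : List A) : Cycle A)
    rw [List.map_map]
    congr 2
    funext a
    exact mul_smul x y a

/-- A divisor of `n` is nonzero in `k` as soon as `n` is; this keeps the coefficients of type (i)
from vanishing. -/
theorem ncard_cycleOrbit_dvd (G : Type*) {A : Type*} [Group G] [MulAction G A] (c : Cycle A) :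
    (cycleOrbit G c).ncard ∣ Nat.card G := by
  let _ : MulAction G (Cycle A) :=
    { smul := translateCycle
      one_smul := translateCycle_one
      mul_smul := translateCycle_mul }
  have h1 : cycleOrbit G c = MulAction.orbit G c := rfl
  rw [h1, ← Nat.card_coe_set_eq, Nat.card_congr (MulAction.orbitEquivQuotientStabilizer G c)]
  exact Subgroup.card_quotient_dvd_card _

variable {k V A : Type*} [Field k] {G : Type*} [Group G] [MulAction G V] [MulAction G A]
  {X : QP k V A} [X.IsActedOnBy G] {R : VertexReps G V}

/-- No cancellation occurs in the potential of the skew quiver. -/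
theorem tildeCycle_mem_support_skewPotential [Finite G]
    (hfree : ∀ v : V, ¬ IsFixedVertex G v → ∀ x : G, x • v = v → x = 1)
    (harr : ∀ a : A, IsFixedVertex G (X.src a) → IsFixedVertex G (X.tgt a) → ∀ h : G, h • a = a)
    (g : G) {ζ : k} (hζ : IsPrimitiveRoot ζ (Nat.card G)) {C : Finset (Cycle A)}
    (hC : IsCrossSection X R C)
    (horb : ∀ c ∈ X.W.support, ∀ d ∈ X.W.support, ∀ μ ν,
      tildeCycle X.toRepQuiver R μ c = tildeCycle X.toRepQuiver R ν d → d ∈ cycleOrbit G c)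
    {c : Cycle A} (hc : c ∈ X.W.support) (μ : ZMod (Nat.card G)) :
    tildeCycle X.toRepQuiver R μ c ∈ (skewPotential X R g ζ C).support := by
  have hn : NeZero (Nat.card G) := ⟨Nat.card_pos.ne'⟩
  have hnk : ((Nat.card G : ℕ) : k) ≠ 0 := hζ.neZero'.out
  obtain ⟨d, ⟨hdC, x, rfl⟩, -⟩ := hC.existsUnique c hc
  have hd := hC.subset hdC
  simp only at hdC hd
  rw [← tildeCycle_translateCycle hfree harr μ x c]
  generalize translateCycle x c = d at hdC hd
  have hW : X.W d ≠ 0 := Finsupp.mem_support_iff.1 hd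
  -- Only the representative `d` contributes: a contribution of another `d'` would put `d'` in the
  -- orbit of `d`, against the choice of the cross-section.
  rw [Finsupp.mem_support_iff, skewPotential, Finsupp.finsetSum_apply,
    Finset.sum_eq_single d]
  · unfold skewTerm
    split_ifs with h1 h2
    · rw [tildeCycle_eq_of_typeI (X.isCycle d hd) h1 μ 0, Finsupp.single_eq_same]
      refine div_ne_zero (mul_ne_zero hW ?_) hnk
      obtain ⟨m, hm⟩ := ncard_cycleOrbit_dvd G d
      intro h0
      rw [hm, Nat.cast_mul, h0, zero_mul] at hnk
      exact hnk rfl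
    all_goals
      rw [Finsupp.finsetSum_apply, Finset.sum_eq_single μ.val]
      · rw [ZMod.natCast_zmod_val, Finsupp.single_eq_same]
        first
        | exact hW
        | exact mul_ne_zero hW (pow_ne_zero _ (inv_ne_zero (hζ.ne_zero hn.out)))
      · intro ν hν hνμ
        rw [Finsupp.single_apply, if_neg]
        intro h
        have h3 := eq_of_tildeCycle_eq h1 h
        apply hνμ
        rw [← h3, ZMod.val_cast_of_lt (Finset.mem_range.1 hν)]
      · intro h
        exact absurd (Finset.mem_range.2 (ZMod.val_lt μ)) h
  · intro d' hd' hne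
    by_contra h0
    have h1 : ∃ ν, tildeCycle X.toRepQuiver R μ d = tildeCycle X.toRepQuiver R ν d' := by
      unfold skewTerm at h0
      split_ifs at h0
      · rw [Finsupp.single_apply] at h0
        exact ⟨0, by_contra fun h => h0 (if_neg fun h' => h h'.symm)⟩
      all_goals
        rw [Finsupp.finsetSum_apply] at h0
        obtain ⟨ν, -, hν⟩ := Finset.exists_ne_zero_of_sum_ne_zero h0
        rw [Finsupp.single_apply] at hν
        exact ⟨ν, by_contra fun h => hν (if_neg fun h' => h h'.symm)⟩
    obtain ⟨ν, hν⟩ := h1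
    have h2 := horb d hd d' (hC.subset hd') μ ν hν
    refine hne ((hC.existsUnique d hd).unique ⟨hd', h2⟩ ⟨hdC, 1, translateCycle_one d⟩)
  · exact fun h => absurd hdC h

end Support

/-! ### Connectedness of the quiver away from the fixed vertex. -/

section Connectivity

variable {k V A : Type*} [Field k] {X : QP k V A}

theorem iff_src_of_isChain {V A : Type*} (Q : RepQuiver V A) (v₀ : V) (χ : V → Prop)
    (hχ : ∀ a, Q.src a ≠ v₀ → Q.tgt a ≠ v₀ → (χ (Q.src a) ↔ χ (Q.tgt a))) (a : A) (l : List A)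
    (hl : (a :: l).IsChain fun a b => Q.tgt a = Q.src b) (ha : Q.src a ≠ v₀)
    (hv : ∀ b ∈ l, Q.src b ≠ v₀) : ∀ b ∈ a :: l, (χ (Q.src b) ↔ χ (Q.src a)) := by
  induction l generalizing a with
  | nil =>
    intro b hb
    obtain rfl : b = a := by simpa using hb
    rfl
  | cons a' l ih =>
    intro b hb
    rw [List.isChain_cons_cons] at hl
    have ha' := hv a' (by simp)
    rcases List.mem_cons.1 hb with rfl | hb
    · rfl
    · rw [ih a' hl.2 ha' (fun b hb => hv b (by simp [hb])) b hb, ← hl.1]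
      exact (hχ a ha (by rwa [hl.1])).symm

/-- If the complement of a vertex in the canvas is connected and every face passes at most once
through that vertex, the quiver stays connected when the vertex is removed. -/
theorem vertex_of_isPreconnected_compl {G : Type*} [Group G] [MulAction G V] {v₀ : V}
    (hv₀ : ∀ v, IsFixedVertex G v ↔ v = v₀)
    (hcount : ∀ c ∈ X.W.support, X.fixedCount G c ≤ 1)
    (hloop : ∀ a, X.src a = v₀ → X.tgt a ≠ v₀)
    (hclosed : IsClosed ({X.vertexPt v₀} : Set X.Canvas))
    (hconn : IsPreconnected ({X.vertexPt v₀}ᶜ : Set X.Canvas)) (χ : V → Prop)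
    (hχ : ∀ a, X.src a ≠ v₀ → X.tgt a ≠ v₀ → (χ (X.src a) ↔ χ (X.tgt a)))
    {v w : V} (hv : v ≠ v₀) (hw : w ≠ v₀) (h : χ v) : χ w := by
  have hmem : ∀ v, X.vertexPt v ∉ ({X.vertexPt v₀} : Set X.Canvas) ↔ v ≠ v₀ := fun v =>
    (X.vertexPt_injective.ne_iff (x := v) (y := v₀))
  have hface : ∀ (c : X.Face) (a b : A), a ∈ c.word → b ∈ c.word → X.src a ≠ v₀ → X.src b ≠ v₀ →
      χ (X.src a) → χ (X.src b) := by
    intro c a b ha hb hav hbv hχa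
    have hnil : c.1 ≠ Cycle.nil := by
      intro h0
      have := X.three_le c.1 c.2
      rw [h0] at this
      simp at this
    obtain ⟨d, l, hdl, hl⟩ := RepQuiver.exists_word_of_fixedCount_le_one hnil (hcount c.1 c.2)
    have hchain : (d :: l).IsChain fun a b => X.tgt a = X.src b := by
      have := X.isCycle c.1 c.2
      rw [hdl] at this
      exact this.isChain
    have hl' : ∀ b ∈ l, X.src b ≠ v₀ := fun b hb h => hl b hb ((hv₀ _).2 h)
    have hmem' : ∀ b, b ∈ c.word → b ∈ d :: l := by
      intro b hb
      have h1 : b ∈ (c.word : Cycle A) := hb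
      rw [c.coe_word, hdl] at h1
      exact h1
    by_cases hd : X.src d = v₀
    · have htail : ∀ b, b ∈ c.word → X.src b ≠ v₀ → b ∈ l := by
        intro b hb hbv
        rcases List.mem_cons.1 (hmem' b hb) with rfl | h
        · exact absurd hd hbv
        · exact h
      have ha' := htail a ha hav
      have hb' := htail b hb hbv
      cases l with
      | nil => simp at ha'
      | cons d' l =>
        rw [List.isChain_cons_cons] at hchain
        have key := iff_src_of_isChain X.toRepQuiver v₀ χ hχ d' l hchain.2 (hl' d' (by simp))
          fun b hb => hl' b (by simp [hb])
        exact (key b hb').2 ((key a ha').1 hχa)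
    · have key := iff_src_of_isChain X.toRepQuiver v₀ χ hχ d l hchain hd hl'
      exact (key b (hmem' b hb)).2 ((key a (hmem' a ha)).1 hχa)
  -- An arrow inherits the property from any end other than `v₀`, and a face from any of its
  -- vertices other than `v₀`. This is consistent by `hface`: deleting at most one passage through
  -- `v₀` leaves a connected path.
  refine X.vertex_of_isPreconnected hclosed hconn χ
    (fun a => (X.src a ≠ v₀ ∧ χ (X.src a)) ∨ (X.tgt a ≠ v₀ ∧ χ (X.tgt a)))
    (fun c => ∃ a ∈ c.word, X.src a ≠ v₀ ∧ χ (X.src a)) ?_ ?_ ?_ ((hmem v).2 hv) ((hmem w).2 hw) h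
  · intro a ha
    rw [hmem] at ha
    refine ⟨?_, fun h => Or.inl ⟨ha, h⟩⟩
    rintro (h | h)
    · exact h.2
    · exact (hχ a ha h.1).2 h.2
  · intro a ha
    rw [hmem] at ha
    refine ⟨?_, fun h => Or.inr ⟨ha, h⟩⟩
    rintro (h | h)
    · exact (hχ a h.1 ha).1 h.2
    · exact h.2
  · intro c i t _
    have hi := List.get_mem c.word i
    have hi' := List.get_mem c.word (QP.cycSucc i)
    have hsucc := c.tgt_get i
    constructor
    · rintro ⟨a, ha, hav, hχa⟩
      by_cases hs : X.src (c.word.get i) = v₀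
      · have ht := hloop _ hs
        refine Or.inr ⟨ht, ?_⟩
        rw [hsucc] at ht ⊢
        exact hface c a _ ha hi' hav ht hχa
      · exact Or.inl ⟨hs, hface c a _ ha hi hav hs hχa⟩
    · rintro (h | h)
      · exact ⟨_, hi, h⟩
      · rw [hsucc] at h
        exact ⟨_, hi', h⟩

theorem exists_ne_vertex [Nontrivial X.Canvas] {v₀ : V} (hloop : ∀ a, X.src a = v₀ → X.tgt a ≠ v₀) :
    ∃ v, v ≠ v₀ := by
  by_contra hcon
  push Not at hcon
  have hA : A → False := fun a => hloop a (hcon _) (hcon _)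
  have hx : ∀ x : X.Canvas, x = X.vertexPt v₀ := by
    intro x
    induction x using X.canvas_cases with
    | hV v => rw [hcon v]
    | hA a t => exact (hA a).elim
    | hF c i r s => exact (hA (c.word.get i)).elim
  obtain ⟨x, y, hxy⟩ := exists_pair_ne X.Canvas
  exact hxy ((hx x).trans (hx y).symm)

theorem exists_incident_arrow [PreconnectedSpace X.Canvas] {v₀ u : V} (hu : u ≠ v₀) :
    ∃ a, X.src a = v₀ ∨ X.tgt a = v₀ := by
  by_contra hcon
  push Not at hcon
  -- Without an arrow at `v₀`, being the cell `v₀` would be a locally constant property on the whole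
  -- canvas.
  refine hu (X.vertex_of_isPreconnected (B := ∅) isClosed_empty
    (by rw [Set.compl_empty]; exact isPreconnected_univ) (fun v => v = v₀) (fun _ => False)
    (fun _ => False) ?_ ?_ ?_ (v := v₀) (w := u) (by simp) (by simp) rfl)
  · intro a _
    simpa using (hcon a).1
  · intro a _
    simpa using (hcon a).2
  · intro c i t _
    rfl

end Connectivity

/-! ### Compatible lifts and the simple connectedness of the skew canvas. -/

/-- This is how agreement of two lifts travels along an arrow in either direction. -/
theorem IsPathLift.zero_iff_one {Z : Type*} [TopologicalSpace Z] {b : Z} {f : C(I, Z)}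
    {φ ψ : I → Σ x : Z, Path.Homotopic.Quotient x b} (hφ : IsPathLift f φ) (hψ : IsPathLift f ψ) :
    φ 0 = ψ 0 ↔ φ 1 = ψ 1 :=
  ⟨fun h => congrFun (hφ.unique hψ h) 1, fun h => congrFun (hφ.unique hψ h) 0⟩

section Skew

variable {k V A : Type*} [Field k] {G : Type*} [Group G] [MulAction G V] [MulAction G A]
  {X : QP k V A} [X.IsActedOnBy G] {R : VertexReps G V} {g : G} {ζ : k} {C : Finset (Cycle A)}
  {hC : IsCrossSection X R C}

/-- The canvas of the skew quiver is simply connected if the canvas of the quiver maps to it in all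
possible ways and these maps have compatible lifts. -/
theorem simplyConnectedSpace_skew_of_lifts {b : (skewQP X R g ζ C hC).Canvas}
    (hfree : ∀ v : V, ¬ IsFixedVertex G v → ∀ x : G, x • v = v → x = 1)
    (Ψ : ZMod (Nat.card G) → C(X.Canvas, (skewQP X R g ζ C hC).Canvas))
    (hV : ∀ μ v, Ψ μ (X.vertexPt v) = (skewQP X R g ζ C hC).vertexPt (tildeVertex R μ v))
    (hA : ∀ μ a, (Ψ μ).comp (X.edgeMap a) =
      (skewQP X R g ζ C hC).edgeMap (tildeArrow X.toRepQuiver R μ a))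
    (φ : ZMod (Nat.card G) → X.Canvas →
      Σ x : (skewQP X R g ζ C hC).Canvas, Path.Homotopic.Quotient x b)
    (hφ : ∀ μ, IsPathLift (Ψ μ) (φ μ))
    (hcons : ∀ μ ν v w, tildeVertex R μ v = tildeVertex R ν w →
      φ μ (X.vertexPt v) = φ ν (X.vertexPt w)) :
    SimplyConnectedSpace (skewQP X R g ζ C hC).Canvas := by
  -- Each vertex of `Q_G` takes its class from an arbitrary preimage; `hcons` makes the choice
  -- immaterial.
  choose m n hmn using exists_tildeVertex_eq R
  refine QP.simplyConnectedSpace_canvas _ (fun z => φ (m z) (X.vertexPt (n z))) (fun z => ?_)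
    fun a' => ?_
  · rw [(hφ _).fst, hV, hmn]
  · obtain ⟨μ, a, rfl⟩ := exists_tildeArrow_eq hfree a'
    refine ⟨φ μ ∘ X.edgeMap a, hA μ a ▸ (hφ μ).comp _, ?_, ?_⟩
    · have h1 : (φ μ ∘ X.edgeMap a) 0 = φ μ (X.vertexPt (X.src a)) := by
        rw [← X.edgePt_zero]
        rfl
      rw [h1]
      refine hcons _ _ _ _ ?_
      rw [hmn]
      exact (src_tildeArrow X.toRepQuiver R μ a).symm
    · have h1 : (φ μ ∘ X.edgeMap a) 1 = φ μ (X.vertexPt (X.tgt a)) := by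
        rw [← X.edgePt_one]
        rfl
      rw [h1]
      refine hcons _ _ _ _ ?_
      rw [hmn]
      exact (tgt_tildeArrow X.toRepQuiver R μ a).symm

theorem exists_skew_maps
    (hW : ∀ c ∈ X.W.support, ∀ μ, tildeCycle X.toRepQuiver R μ c ∈ (skewPotential X R g ζ C).support) :
    ∃ Ψ : ZMod (Nat.card G) → C(X.Canvas, (skewQP X R g ζ C hC).Canvas),
      (∀ μ v, Ψ μ (X.vertexPt v) = (skewQP X R g ζ C hC).vertexPt (tildeVertex R μ v)) ∧
      ∀ μ a, (Ψ μ).comp (X.edgeMap a) =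
        (skewQP X R g ζ C hC).edgeMap (tildeArrow X.toRepQuiver R μ a) := by
  choose Ψ hV hA using fun μ => X.exists_canvas_hom (skewQP X R g ζ C hC) (tildeVertex R μ)
    (tildeArrow X.toRepQuiver R μ) (src_tildeArrow X.toRepQuiver R μ)
    (tgt_tildeArrow X.toRepQuiver R μ) fun c hc => hW c hc μ
  exact ⟨Ψ, hV, fun μ a => ContinuousMap.ext fun t => hA μ a t⟩

end Skew

section Skew

variable {k V A : Type*} [Field k] {G : Type*} [Group G] [MulAction G V] [MulAction G A]
  {X : QP k V A} [X.IsActedOnBy G] {R : VertexReps G V} {g : G} {ζ : k} {C : Finset (Cycle A)}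
  {hC : IsCrossSection X R C}

/-- All vertices are fixed and `ZMod 1` has one element, so distinct vertices have distinct images
and a single lift is consistent. -/
theorem simplyConnectedSpace_skew_of_subsingleton [Subsingleton G] (hX : SimplyConnectedSpace X.Canvas)
    (hfix : ∃ v : V, IsFixedVertex G v) (hζ : IsPrimitiveRoot ζ (Nat.card G)) :
    SimplyConnectedSpace (skewQP X R g ζ C hC).Canvas := by
  have hone : ∀ x : G, x = 1 := fun x => Subsingleton.elim _ _
  have hfixed : ∀ v : V, IsFixedVertex G v := fun v x => by rw [hone x, one_smul]
  have hfree : ∀ v : V, ¬ IsFixedVertex G v → ∀ x : G, x • v = v → x = 1 :=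
    fun v hv => absurd (hfixed v) hv
  have harr : ∀ a : A, ∀ h : G, h • a = a := fun a x => by rw [hone x, one_smul]
  have hcard : Nat.card G = 1 := Nat.card_unique
  have hsub : Subsingleton (ZMod (Nat.card G)) := by
    rw [hcard]
    infer_instance
  have hW : ∀ c ∈ X.W.support, ∀ μ,
      tildeCycle X.toRepQuiver R μ c ∈ (skewPotential X R g ζ C).support := by
    refine fun c hc μ => tildeCycle_mem_support_skewPotential hfree (fun a _ _ => harr a) g hζ hC
      ?_ hc μ
    intro c _ d _ μ ν h
    refine ⟨1, ?_⟩
    change translateCycle 1 c = d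
    rw [translateCycle_one]
    obtain rfl : μ = ν := Subsingleton.elim _ _
    have hinj : Function.Injective (tildeArrow X.toRepQuiver R μ) := fun a b hab => by
      obtain ⟨x, hx⟩ := exists_smul_of_tildeArrow_eq X.toRepQuiver R hab
      rw [hx, harr]
    induction c using Quotient.inductionOn' with
    | h l =>
      induction d using Quotient.inductionOn' with
      | h m =>
        have h1 : (l.map (tildeArrow X.toRepQuiver R μ)) ~r (m.map (tildeArrow X.toRepQuiver R μ)) :=
          Quotient.exact h
        obtain ⟨n, hn⟩ := h1
        rw [← List.map_rotate] at hn
        exact Quotient.sound ⟨n, hinj.list_map hn⟩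
  obtain ⟨Ψ, hV, hA⟩ := exists_skew_maps (hC := hC) hW
  obtain ⟨v, -⟩ := hfix
  choose φ hφ hφ' using fun μ => IsPathLift.exists_of_eq (b := Ψ 0 (X.vertexPt v)) (Ψ μ)
    (X.vertexPt v) ⟨_, Path.Homotopic.Quotient.refl _⟩ (by rw [Subsingleton.elim μ 0])
  refine simplyConnectedSpace_skew_of_lifts hfree Ψ hV hA φ hφ fun μ ν v w h => ?_
  obtain ⟨rfl, rfl⟩ := tildeVertex_eq_of_fixed R (hfixed v) h
  rfl

theorem simplyConnectedSpace_skew_of_nontrivial [Finite G] (hX : SimplyConnectedSpace X.Canvas)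
    (hdisk : Nonempty (X.Canvas ≃ₜ QP.Disk))
    {v₀ : V} (hv₀ : ∀ v, IsFixedVertex G v ↔ v = v₀)
    (hfree : ∀ v, v ≠ v₀ → ∀ x : G, x • v = v → x = 1)
    (hloop : ∀ a, X.src a = v₀ → X.tgt a ≠ v₀)
    (htypes : ∀ c ∈ X.W.support, X.TypeI G c ∨ X.TypeII G c ∨ X.TypeIII G c ∨ X.TypeIV G c)
    (hζ : IsPrimitiveRoot ζ (Nat.card G)) :
    SimplyConnectedSpace (skewQP X R g ζ C hC).Canvas := by
  obtain ⟨e⟩ := hdisk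
  have hfixed : IsFixedVertex G v₀ := (hv₀ v₀).2 rfl
  have hnot : ∀ v, v ≠ v₀ → ¬ IsFixedVertex G v := fun v hv h => hv ((hv₀ v).1 h)
  have hfree' : ∀ v : V, ¬ IsFixedVertex G v → ∀ x : G, x • v = v → x = 1 :=
    fun v hv => hfree v fun h => hv ((hv₀ v).2 h)
  have hloop' : ∀ a, IsFixedVertex G (X.src a) → ¬ IsFixedVertex G (X.tgt a) :=
    fun a hs ht => hloop a ((hv₀ _).1 hs) ((hv₀ _).1 ht)
  have harr : ∀ a : A, IsFixedVertex G (X.src a) → IsFixedVertex G (X.tgt a) → ∀ h : G, h • a = a :=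
    fun a hs ht => absurd ht (hloop' a hs)
  -- At most half of the passages are through fixed vertices; for length at least three this rules
  -- out types (iii) and (iv).
  have hcount : ∀ c ∈ X.W.support, X.fixedCount G c ≤ 1 := by
    intro c hc
    have h1 := RepQuiver.two_mul_fixedCount_le (X.isCycle c hc) hloop'
    have h2 := X.three_le c hc
    rcases htypes c hc with h | h | h | h
    · have : X.fixedCount G c = 0 := h
      omega
    · have : X.fixedCount G c = 1 := h
      omega
    · have : X.fixedCount G c + 1 = c.length := h
      omega
    · have : X.fixedCount G c = c.length := h
      omega
  have hW : ∀ c ∈ X.W.support, ∀ μ,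
      tildeCycle X.toRepQuiver R μ c ∈ (skewPotential X R g ζ C).support := by
    refine fun c hc μ => tildeCycle_mem_support_skewPotential hfree' harr g hζ hC ?_ hc μ
    intro c hc d hd μ ν h
    refine mem_cycleOrbit_of_tildeCycle_eq hfree' (X.isCycle c hc) (X.isCycle d hd) ?_
      (hcount c hc) h
    rintro rfl
    have := X.three_le _ hc
    simp at this
  obtain ⟨Ψ, hV, hA⟩ := exists_skew_maps (hC := hC) hW
  have hnt : Nontrivial X.Canvas := by
    refine ⟨e.symm ⟨0, by simp⟩, e.symm ⟨1, by simp⟩, fun h => ?_⟩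
    have := congrArg Subtype.val (e.symm.injective h)
    simp at this
  obtain ⟨u, hu⟩ := exists_ne_vertex (X := X) hloop
  have hconn : ∀ (χ : V → Prop)
      (_ : ∀ a, X.src a ≠ v₀ → X.tgt a ≠ v₀ → (χ (X.src a) ↔ χ (X.tgt a)))
      {v w : V} (_ : v ≠ v₀) (_ : w ≠ v₀) (_ : χ v), χ w := by
    have : T1Space X.Canvas := e.symm.t1Space
    exact vertex_of_isPreconnected_compl hv₀ hcount hloop isClosed_singleton
      (X.isPreconnected_compl_singleton e _)
  have hbase : ∀ μ, tildeVertex R μ u = tildeVertex R 0 u := fun μ => by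
    simp [tildeVertex, hnot u hu]
  -- All `Ψ μ` agree at the free vertex `u`, so every lift can start there with the constant path.
  choose φ hφ hφ' using fun μ => IsPathLift.exists_of_eq (b := Ψ 0 (X.vertexPt u)) (Ψ μ)
    (X.vertexPt u) ⟨_, Path.Homotopic.Quotient.refl _⟩ (by rw [hV, hV, hbase μ])
  have hE : ∀ μ a, IsPathLift ((skewQP X R g ζ C hC).edgeMap (tildeArrow X.toRepQuiver R μ a))
      (φ μ ∘ X.edgeMap a) := fun μ a => hA μ a ▸ (hφ μ).comp _
  have hE0 : ∀ μ a, (φ μ ∘ X.edgeMap a) 0 = φ μ (X.vertexPt (X.src a)) := fun μ a => by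
    rw [← X.edgePt_zero]
    rfl
  have hE1 : ∀ μ a, (φ μ ∘ X.edgeMap a) 1 = φ μ (X.vertexPt (X.tgt a)) := fun μ a => by
    rw [← X.edgePt_one]
    rfl
  -- Arrows between free vertices have the same image under all `Ψ μ`, so agreement at `u` spreads
  -- over the quiver without `v₀`.
  have hindep : ∀ μ ν v, v ≠ v₀ → φ μ (X.vertexPt v) = φ ν (X.vertexPt v) := by
    intro μ ν v hv
    refine hconn (fun v => φ μ (X.vertexPt v) = φ ν (X.vertexPt v)) (fun a hs ht => ?_) hu hv
      ((hφ' μ).trans (hφ' ν).symm)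
    have h1 := hE ν a
    rw [tildeArrow_eq_of_not_fixed X.toRepQuiver R (hnot _ hs) (hnot _ ht) ν μ] at h1
    have := (hE μ a).zero_iff_one h1
    rwa [hE0, hE1, hE0, hE1] at this
  have hstep : ∀ (μ : ZMod (Nat.card G)) (x : G) (a : A), φ μ (X.vertexPt (x • X.src a)) = φ μ (X.vertexPt (X.src a)) ↔
      φ μ (X.vertexPt (x • X.tgt a)) = φ μ (X.vertexPt (X.tgt a)) := by
    intro μ x a
    have h1 := hE μ (x • a)
    rw [tildeArrow_smul hfree' harr] at h1
    have := h1.zero_iff_one (hE μ a)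
    rwa [hE0, hE1, hE0, hE1, RepQuiver.IsActedOnBy.src_smul, RepQuiver.IsActedOnBy.tgt_smul] at this
  have hequiv : ∀ (μ : ZMod (Nat.card G)) (x : G) (v : V), v ≠ v₀ → φ μ (X.vertexPt (x • v)) = φ μ (X.vertexPt v) := by
    intro μ x v hv
    -- For an arrow `a` at `v₀`, the arrows `a` and `x • a` have the same image, and the lifts over
    -- it agree at the end `v₀`, which `x` fixes; hence they agree at the free end.
    have hinc : ∃ w, w ≠ v₀ ∧ φ μ (X.vertexPt (x • w)) = φ μ (X.vertexPt w) := by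
      obtain ⟨a, ha⟩ := exists_incident_arrow (X := X) hu
      rcases ha with ha | ha
      · exact ⟨X.tgt a, hloop a ha, (hstep μ x a).1 (by rw [ha, hfixed x])⟩
      · exact ⟨X.src a, fun h => hloop a h ha, (hstep μ x a).2 (by rw [ha, hfixed x])⟩
    obtain ⟨w, hw, hw'⟩ := hinc
    exact hconn (fun v => φ μ (X.vertexPt (x • v)) = φ μ (X.vertexPt v))
      (fun a _ _ => hstep μ x a) hw hv hw'
  refine simplyConnectedSpace_skew_of_lifts hfree' Ψ hV hA φ hφ fun μ ν v w h => ?_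
  by_cases hv : v = v₀
  · obtain ⟨rfl, rfl⟩ := tildeVertex_eq_of_fixed R ((hv₀ v).2 hv) h
    rfl
  · obtain ⟨x, rfl⟩ := tildeVertex_eq_of_not_fixed R (hnot v hv) h
    rw [hequiv ν x v hv]
    exact hindep μ ν v hv

end Skew

end

theorem mainTheorem9 {k V A G : Type*} [Field k] [Finite V] [Finite A] [Group G]
    [MulAction G V] [MulAction G A]
    (X : QP k V A) [X.IsActedOnBy G] (hX : X.IsStronglyPlanar)
    (hrot : ActsByRotations X G)
    (hfix : ∃ v : V, IsFixedVertex G v)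
    -- standing assumption: arrows between two fixed vertices are fixed
    (harr : ∀ a : A, IsFixedVertex G (X.src a) → IsFixedVertex G (X.tgt a) → ∀ h : G, h • a = a)
    (g : G) (hg : ∀ x : G, x ∈ Subgroup.zpowers g)
    (ζ : k) (hζ : IsPrimitiveRoot ζ (Nat.card G))
    (R : VertexReps G V) (C : Finset (Cycle A)) (hC : IsCrossSection X R C) :
    SimplyConnectedSpace (skewQP X R g ζ C hC).Canvas := by
  have hG : Finite G := hrot.finite
  rcases subsingleton_or_nontrivial G with hG' | hG'
  · exact simplyConnectedSpace_skew_of_subsingleton hX.1.1 hfix hζ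
  · obtain ⟨v₀, hv₀, hfree, hloop⟩ := hrot.exists_unique_fixed hfix harr hG'
    exact simplyConnectedSpace_skew_of_nontrivial hX.1.1 hX.2 hv₀ hfree hloop hrot.types hζ
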